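/- **Definitions.** For a sequence $M=(M_k)_{k\in\mathbb N}$ of positive reals ($\mathbb N=\{0,1,2,\dots\}$) put $m_k:=M_k/k!$, $\mu_0:=1$ and $\mu_k:=M_k/M_{k-1}$ for $k\ge 1$ (for a sequence $N^l$ write $n^l_k:=N^l_k/k!$). Let $\mathcal{LC}$ be the set of all such $M$ with $1=M_0\le M_1$, $M_j^2\le M_{j-1}M_{j+1}$ for all $j\ge1$, and $\lim_{k\to\infty}(M_k)^{1/k}=\infty$. We say that $M$ has $(\beta_3)$ if $\liminf_{p\to\infty}\mu_{Qp}/\mu_p>1$ for some integer $Q\ge1$, and $(\mathrm{mg})$ if there is $C\ge1$ with $M_{j+k}\le C^{j+k}M_jM_k$ for all $j,k\in\mathbb N$. Write $M\approx N$ if there are $C_1,C_2\ge1$ with $M_p\le C_2C_1^pN_p$ and $N_p\le C_2C_1^pM_p$ for all $p$. Let $\mathcal W_0$ be the set of all continuous, increasing (i.e. non-decreasing) $\omega:[0,\infty)\to[0,\infty)$ with $\omega=0$ on $[0,1]$, $\lim_{t\to\infty}\omega(t)=\infty$, $\log t=o(\omega(t))$ as $t\to\infty$, and $\varphi_\omega(t):=\omega(e^t)$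 convex on $\mathbb R$. Let $\mathcal W$ be the set of all $\omega\in\mathcal W_0$ with $\omega(2t)=O(\omega(t))$ as $t\to\infty$. Further conditions: $(\omega_2)$ $\omega(t)=O(t)$ as $t\to\infty$; $(\omega_5)$ $\omega(t)=o(t)$ as $t\to\infty$; $(\omega_6)$ there is $H\ge1$ with $2\omega(t)\le\omega(Ht)+H$ for all $t\ge0$. Write $\sigma\sim\tau$ if $\sigma=O(\tau)$ and $\tau=O(\sigma)$ as $t\to\infty$. Put $\varphi^*_\omega(x):=\sup_{y\ge0}(xy-\varphi_\omega(y))$ for $x\ge0$. The associated function of $M$ is $\omega_M(t):=\sup_{p\in\mathbb N}\log(t^pM_0/M_p)$ for $t>0$, $\omega_M(0):=0$. Let $U\subseteq\mathbb R^r$ be non-empty open and $s\ge1$. For a positive sequence $w$ and a set $K$ put $\|f\|_{w,K}:=\sup_{k\in\mathbb N,\,x\in K}\|f^{(k)}(x)\|/w_k$, with the operator norm of the $k$-th Fréchet derivative. Given a family $(w^l)_{l>0}$ of positive sequences, the Roumieu (resp. Beurling) class consists of all smooth $f:U\to\mathbb R^s$ such that for every compact $K\subseteq U$ one has $\|f\|_{w^l,K}<\infty$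 for some (resp. for every) $l>0$. It carries the topology of the projective limit, over the open sets $V$ with compact closure in $U$, of the locally convex inductive limits (resp. projective limits) over $l>0$ of the normed spaces of all smooth functions $f$ on $V$ with $\|f\|_{w^l,V}<\infty$. For $w^l_k=l^kM_k$ this space is denoted by $\mathcal E_{\{M\}}(U)$ (resp. $\mathcal E_{(M)}(U)$), and for $w^l_k=\exp(\frac1l\varphi^*_\omega(lk))$ by $\mathcal E_{\{\omega\}}(U)$ (resp. $\mathcal E_{(\omega)}(U)$). In an equality of spaces $\mathcal E_{[\cdot]}(U)$, all the spaces are of Roumieu type or all are of Beurling type, and both equalities are asserted. **Theorem.** Let $M\in\mathcal{LC}$ have $(\beta_3)$ and $(\mathrm{mg})$. Let $r,s\ge 1$ and let $U\subseteq\mathbb R^r$ be non-empty open. For $l>0$ put $N^l_p:=\exp(\frac1l\varphi^*_{\omega_M}(lp))$, $p\in\mathbb N$. All suprema defining $\omega_M$, $\varphi^*_{\omega_M}$ and $\omega_{N^l}$ are finite, and the following hold. 1. $\omega_M\in\mathcal W$, and $\omega_M$ has $(\omega_6)$. 2. $\mathcal E_{[\omega_M]}(U)=\mathcal E_{[N^l]}(U)=\mathcal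 E_{[M]}(U)$ for each $l>0$, as locally convex spaces. Moreover $N^1=M$, and for each $l>0$: (a) $N^l\in\mathcal{LC}$ and $N^l$ has $(\mathrm{mg})$; (b) $\omega_{N^l}\sim\omega_M$, $\omega_{N^l}\in\mathcal W$, and $\omega_{N^l}$ has $(\omega_6)$; (c) $M\approx N^l$. 3. If $\liminf_{p\to\infty}(m_p)^{1/p}>0$, then (a) $\omega_M$ and each $\omega_{N^l}$, $l>0$, have $(\omega_2)$; (b) each $N^l$ has $(\beta_3)$ and $\liminf_{p\to\infty}(n^l_p)^{1/p}>0$. If $\lim_{p\to\infty}(m_p)^{1/p}=\infty$, then (c) $\omega_M$ and each $\omega_{N^l}$ have $(\omega_5)$; (d) $\lim_{p\to\infty}(n^l_p)^{1/p}=\infty$ for each $l>0$. -/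

import Mathlib

open Filter Topology Asymptotics TopologicalSpace
open scoped ENNReal Nat

noncomputable section

namespace Ultra

/-! ### Weight sequences -/

/-- The sequence of quotients `μ_0 = 1`, `μ_k = M_k / M_{k-1}`. -/
def quotSeq (M : ℕ → ℝ) : ℕ → ℝ
  | 0 => 1
  | k + 1 => M (k + 1) / M k

/-- The sequence `m_k = M_k / k!`. -/
def divFact (M : ℕ → ℝ) (k : ℕ) : ℝ := M k / (k ! : ℝ)

/-- The `k`-th root `(a_k)^{1/k}` (only used as `k → ∞`). -/
def rootSeq (a : ℕ → ℝ) (k : ℕ) : ℝ := a k ^ (1 / (k : ℝ))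

/-- The set `LC`: positive, normalized, log-convex sequences with `(M_k)^{1/k} → ∞`. -/
structure IsLC (M : ℕ → ℝ) : Prop where
  pos : ∀ k, 0 < M k
  zero : M 0 = 1
  one_le : 1 ≤ M 1
  logConvex : ∀ j, M (j + 1) ^ 2 ≤ M j * M (j + 2)
  root_tendsto : Tendsto (rootSeq M) atTop atTop

/-- Moderate growth, condition `(mg)`. -/
def ModerateGrowth (M : ℕ → ℝ) : Prop :=
  ∃ C : ℝ, 1 ≤ C ∧ ∀ j k : ℕ, M (j + k) ≤ C ^ (j + k) * (M j * M k)

/-- Condition `(β₃)`; the lower limit is taken in the extended reals. -/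
def Beta3 (M : ℕ → ℝ) : Prop :=
  ∃ Q : ℕ, 0 < Q ∧
    1 < liminf (fun p : ℕ => ((quotSeq M (Q * p) / quotSeq M p : ℝ) : EReal)) atTop

/-- `liminf (m_p)^{1/p} > 0` where `m_p = M_p / p!`. -/
def LiminfRootPos (M : ℕ → ℝ) : Prop :=
  0 < liminf (fun p : ℕ => ((rootSeq (divFact M) p : ℝ) : EReal)) atTop

/-- `lim (m_p)^{1/p} = ∞` where `m_p = M_p / p!`. -/
def LimRootTop (M : ℕ → ℝ) : Prop :=
  Tendsto (rootSeq (divFact M)) atTop atTop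

/-- The relation `M ≼ N` between weight sequences. -/
def SeqLE (M N : ℕ → ℝ) : Prop :=
  ∃ C₁ C₂ : ℝ, 1 ≤ C₁ ∧ 1 ≤ C₂ ∧ ∀ p : ℕ, M p ≤ C₂ * C₁ ^ p * N p

/-- Equivalence `M ≈ N` of weight sequences. -/
def SeqEquiv (M N : ℕ → ℝ) : Prop := SeqLE M N ∧ SeqLE N M

/-! ### Weight functions

A weight function lives on `[0, ∞)`; it is a function `ℝ → ℝ` of which only the values on
`[0, ∞)` matter. -/

/-- `φ_ω(t) = ω(e^t)`. -/
def phi (ω : ℝ → ℝ) (t : ℝ) : ℝ := ω (Real.exp t)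

/-- Conditions `(ω₀)`, `(ω₃)`, `(ω₄)`: the set `W₀`. -/
structure IsW0 (ω : ℝ → ℝ) : Prop where
  nonneg : ∀ t, 0 ≤ t → 0 ≤ ω t
  continuousOn : ContinuousOn ω (Set.Ici 0)
  monotoneOn : MonotoneOn ω (Set.Ici 0)
  eq_zero : ∀ t ∈ Set.Icc (0 : ℝ) 1, ω t = 0
  tendsto : Tendsto ω atTop atTop
  om3 : Real.log =o[atTop] ω
  om4 : ConvexOn ℝ Set.univ (phi ω)

/-- The set `W`: members of `W₀` with `(ω₁)`, that is `ω(2t) = O(ω(t))`. -/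
structure IsW (ω : ℝ → ℝ) : Prop extends IsW0 ω where
  om1 : (fun t => ω (2 * t)) =O[atTop] ω

/-- Condition `(ω₂)`. -/
def Om2 (ω : ℝ → ℝ) : Prop := ω =O[atTop] (fun t : ℝ => t)

/-- Condition `(ω₅)`. -/
def Om5 (ω : ℝ → ℝ) : Prop := ω =o[atTop] (fun t : ℝ => t)

/-- Condition `(ω₆)`. -/
def Om6 (ω : ℝ → ℝ) : Prop :=
  ∃ H : ℝ, 1 ≤ H ∧ ∀ t, 0 ≤ t → 2 * ω t ≤ ω (H * t) + H

/-- Equivalence `σ ∼ τ` of weight functions. -/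
def FunEquiv (σ τ : ℝ → ℝ) : Prop := τ =O[atTop] σ ∧ σ =O[atTop] τ

/-- The values whose supremum is `φ*_ω(x)`. -/
def conjSet (ω : ℝ → ℝ) (x : ℝ) : Set ℝ := (fun y => x * y - phi ω y) '' Set.Ici 0

/-- The Young conjugate `φ*_ω(x) = sup {x y - φ_ω(y) : y ≥ 0}`. -/
def conj (ω : ℝ → ℝ) (x : ℝ) : ℝ := sSup (conjSet ω x)

/-- The suprema defining `φ*_ω` on `[0, ∞)` are finite. -/
def ConjFinite (ω : ℝ → ℝ) : Prop := ∀ x, 0 ≤ x → BddAbove (conjSet ω x)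

/-- The sequence `Ω^l_p = exp ((1/l) φ*_ω(l p))`. -/
def assocSeq (ω : ℝ → ℝ) (l : ℝ) (p : ℕ) : ℝ := Real.exp (1 / l * conj ω (l * p))

/-- The values whose supremum is `ω_M(t)`, `t > 0`. -/
def assocSet (M : ℕ → ℝ) (t : ℝ) : Set ℝ :=
  Set.range fun p : ℕ => Real.log (t ^ p * M 0 / M p)

/-- The associated function `ω_M(t) = sup_p log (t^p M_0 / M_p)` for `t > 0`, `ω_M(0) = 0`. -/
def assocFun (M : ℕ → ℝ) (t : ℝ) : ℝ := if t = 0 then 0 else sSup (assocSet M t)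

/-- The suprema defining `ω_M` are finite. -/
def AssocFinite (M : ℕ → ℝ) : Prop := ∀ t, 0 < t → BddAbove (assocSet M t)

/-! ### Spaces of ultradifferentiable functions

A function on an open set `V` is represented by its extension by zero to the whole space. -/

variable {E F : Type*} [NormedAddCommGroup E] [NormedSpace ℝ E]
  [NormedAddCommGroup F] [NormedSpace ℝ F]

/-- The space `𝓔(V, F)` of smooth functions on the open set `V`. -/
def smoothSpace (F : Type*) [NormedAddCommGroup F] [NormedSpace ℝ F] (V : Opens E) :
    Submodule ℝ (E → F) where
  carrier := {f | ContDiffOn ℝ (⊤ : ℕ∞) f V ∧ ∀ x ∉ V, f x = 0}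
  add_mem' := fun {f g} hf hg =>
    ⟨hf.1.add hg.1, fun x hx => by simp [hf.2 x hx, hg.2 x hx]⟩
  zero_mem' := ⟨contDiffOn_const, fun _ _ => rfl⟩
  smul_mem' := fun c f hf => ⟨hf.1.const_smul c, fun x hx => by simp [hf.2 x hx]⟩

/-- `sup_{k ∈ ℕ, x ∈ K} ‖f^{(k)}(x)‖ / w_k ∈ [0, ∞]` for a positive sequence `w`, where `‖·‖` is
the operator norm of `k`-linear maps. -/
def supNorm (w : ℕ → ℝ) (K : Set E) (f : E → F) : ℝ≥0∞ :=
  ⨆ (k : ℕ) (x ∈ K), ENNReal.ofReal (‖iteratedFDeriv ℝ k f x‖ / w k)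

theorem le_supNorm (w : ℕ → ℝ) {K : Set E} (f : E → F) (k : ℕ) {x : E} (hx : x ∈ K) :
    ENNReal.ofReal (‖iteratedFDeriv ℝ k f x‖ / w k) ≤ supNorm w K f :=
  le_iSup_of_le k (le_iSup₂_of_le x hx le_rfl)

theorem supNorm_mono (w : ℕ → ℝ) {K L : Set E} (h : K ⊆ L) (f : E → F) :
    supNorm w K f ≤ supNorm w L f :=
  iSup_le fun k => iSup₂_le fun _ hx => le_supNorm w f k (h hx)

theorem supNorm_add_le (w : ℕ → ℝ) (V : Opens E) {f g : E → F}
    (hf : f ∈ smoothSpace F V) (hg : g ∈ smoothSpace F V) :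
    supNorm w (V : Set E) (f + g) ≤ supNorm w (V : Set E) f + supNorm w (V : Set E) g := by
  refine iSup_le fun k => iSup₂_le fun x hx => ?_
  have hx' : (V : Set E) ∈ 𝓝 x := V.isOpen.mem_nhds hx
  have h1 : ContDiffAt ℝ k f x := (hf.1.contDiffAt hx').of_le (by exact_mod_cast le_top)
  have h2 : ContDiffAt ℝ k g x := (hg.1.contDiffAt hx').of_le (by exact_mod_cast le_top)
  refine le_trans ?_ (add_le_add (le_supNorm w f k hx) (le_supNorm w g k hx))
  rw [iteratedFDeriv_add_apply h1 h2]
  rcases le_or_gt 0 (w k) with hw | hw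
  · rw [← ENNReal.ofReal_add (by positivity) (by positivity), ← add_div]
    exact ENNReal.ofReal_le_ofReal (div_le_div_of_nonneg_right (norm_add_le _ _) hw)
  · rw [ENNReal.ofReal_of_nonpos (div_nonpos_of_nonneg_of_nonpos (norm_nonneg _) hw.le)]
    exact zero_le

theorem supNorm_smul_le (w : ℕ → ℝ) (V : Opens E) (c : ℝ) {f : E → F}
    (hf : f ∈ smoothSpace F V) :
    supNorm w (V : Set E) (c • f) ≤ ENNReal.ofReal ‖c‖ * supNorm w (V : Set E) f := by
  refine iSup_le fun k => iSup₂_le fun x hx => ?_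
  have hx' : (V : Set E) ∈ 𝓝 x := V.isOpen.mem_nhds hx
  have h1 : ContDiffAt ℝ k f x := (hf.1.contDiffAt hx').of_le (by exact_mod_cast le_top)
  refine le_trans ?_ (mul_le_mul_right (le_supNorm w f k hx) _)
  rw [iteratedFDeriv_const_smul_apply h1, norm_smul, mul_div_assoc,
    ENNReal.ofReal_mul (norm_nonneg c)]

theorem supNorm_zero (w : ℕ → ℝ) (V : Opens E) :
    supNorm w (V : Set E) (0 : E → F) = 0 := by
  have h := supNorm_smul_le w V 0 (smoothSpace F V).zero_mem
  simpa using h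

/-- The space of all `f ∈ 𝓔(V, F)` with `supNorm w V f < ∞`. -/
def stepSpace (F : Type*) [NormedAddCommGroup F] [NormedSpace ℝ F] (w : ℕ → ℝ) (V : Opens E) :
    Submodule ℝ (E → F) where
  carrier := {f | f ∈ smoothSpace F V ∧ supNorm w (V : Set E) f < ∞}
  add_mem' := fun {f g} hf hg => ⟨(smoothSpace F V).add_mem hf.1 hg.1,
    (supNorm_add_le w V hf.1 hg.1).trans_lt (ENNReal.add_lt_top.2 ⟨hf.2, hg.2⟩)⟩
  zero_mem' := ⟨(smoothSpace F V).zero_mem, by rw [supNorm_zero]; exact ENNReal.zero_lt_top⟩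
  smul_mem' := fun c f hf => ⟨(smoothSpace F V).smul_mem c hf.1,
    (supNorm_smul_le w V c hf.1).trans_lt (ENNReal.mul_lt_top ENNReal.ofReal_lt_top hf.2)⟩

/-- The norm of `stepSpace F w V`. -/
def stepNorm (F : Type*) [NormedAddCommGroup F] [NormedSpace ℝ F] (w : ℕ → ℝ) (V : Opens E) :
    Seminorm ℝ (stepSpace F w V) :=
  Seminorm.ofSMulLE (fun f => (supNorm w (V : Set E) (f : E → F)).toReal)
    (by simp [supNorm_zero])
    (fun f g => by
      rw [← ENNReal.toReal_add f.2.2.ne g.2.2.ne]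
      exact ENNReal.toReal_mono (ENNReal.add_lt_top.2 ⟨f.2.2, g.2.2⟩).ne
        (supNorm_add_le w V f.2.1 g.2.1))
    (fun c f => by
      have h := ENNReal.toReal_mono (ENNReal.mul_lt_top ENNReal.ofReal_lt_top f.2.2).ne
        (supNorm_smul_le w V c f.2.1)
      rwa [ENNReal.toReal_mul, ENNReal.toReal_ofReal (norm_nonneg c)] at h)

/-- The norm topology of `stepSpace F w V`. -/
def stepTopology (F : Type*) [NormedAddCommGroup F] [NormedSpace ℝ F] (w : ℕ → ℝ)
    (V : Opens E) : TopologicalSpace (stepSpace F w V) :=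
  (stepNorm F w V).toSeminormedAddCommGroup.toUniformSpace.toTopologicalSpace

/-- The (span of the) union over all `l > 0` of the spaces `stepSpace F (W l) V`. -/
def unionSpace (F : Type*) [NormedAddCommGroup F] [NormedSpace ℝ F] (W : ℝ → ℕ → ℝ)
    (V : Opens E) : Submodule ℝ (E → F) :=
  ⨆ (l : ℝ) (_ : 0 < l), stepSpace F (W l) V

theorem stepSpace_le_unionSpace (W : ℝ → ℕ → ℝ) (V : Opens E) {l : ℝ} (hl : 0 < l) :
    stepSpace F (W l) V ≤ unionSpace F W V :=
  le_iSup₂_of_le l hl le_rfl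

/-- The locally convex inductive limit topology on the union over `l > 0` of the spaces
`stepSpace F (W l) V`: the finest locally convex vector space topology for which all
inclusions of these normed spaces are continuous. -/
def inductiveTopology (F : Type*) [NormedAddCommGroup F] [NormedSpace ℝ F] (W : ℝ → ℕ → ℝ)
    (V : Opens E) : TopologicalSpace (unionSpace F W V) :=
  sInf {t | @IsTopologicalAddGroup (unionSpace F W V) t _ ∧
    @ContinuousSMul ℝ (unionSpace F W V) _ _ t ∧
    @LocallyConvexSpace ℝ (unionSpace F W V) _ _ _ _ t ∧
    ∀ (l : ℝ) (hl : 0 < l), @Continuous _ _ (stepTopology F (W l) V) t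
      (Submodule.inclusion (stepSpace_le_unionSpace W V hl))}

/-- `V` is relatively compact in `U`. -/
def RelCompact (V U : Opens E) : Prop :=
  IsCompact (closure (V : Set E)) ∧ closure (V : Set E) ⊆ U

theorem restrict_mem (w : ℕ → ℝ) {U V : Opens E} (h : RelCompact V U) {f : E → F}
    (hf : f ∈ smoothSpace F U) (hfin : supNorm w (closure (V : Set E)) f < ∞) :
    (V : Set E).indicator f ∈ stepSpace F w V := by
  have hVU : (V : Set E) ⊆ U := subset_closure.trans h.2
  refine ⟨⟨?_, fun x hx => Set.indicator_of_notMem hx f⟩, ?_⟩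
  · exact (hf.1.mono hVU).congr fun x hx => Set.indicator_of_mem hx f
  · refine lt_of_le_of_lt ?_ ((supNorm_mono w subset_closure f).trans_lt hfin)
    refine iSup_le fun k => iSup₂_le fun x hx => ?_
    have he : (V : Set E).indicator f =ᶠ[𝓝 x] f := by
      filter_upwards [V.isOpen.mem_nhds hx] with y hy using Set.indicator_of_mem hy f
    rw [(he.iteratedFDeriv ℝ k).eq_of_nhds]
    exact le_supNorm w f k hx

/-- A set of functions together with a topology. The vector space operations are always the
pointwise ones, so two such spaces are equal as locally convex spaces if and only if they
consist of the same functions and carry the same topology. -/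
structure FunctionSpace (E F : Type*) where
  carrier : Set (E → F)
  topology : TopologicalSpace carrier

/-- Functions of Roumieu type: for every compact `K ⊆ U` there is `l > 0` such that
`supNorm (W l) K f < ∞`. -/
def roumieuSet (F : Type*) [NormedAddCommGroup F] [NormedSpace ℝ F] (W : ℝ → ℕ → ℝ)
    (U : Opens E) : Set (E → F) :=
  {f | f ∈ smoothSpace F U ∧
    ∀ K : Set E, IsCompact K → K ⊆ U → ∃ l : ℝ, 0 < l ∧ supNorm (W l) K f < ∞}

/-- Functions of Beurling type: for every compact `K ⊆ U` and every `l > 0` one has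
`supNorm (W l) K f < ∞`. -/
def beurlingSet (F : Type*) [NormedAddCommGroup F] [NormedSpace ℝ F] (W : ℝ → ℕ → ℝ)
    (U : Opens E) : Set (E → F) :=
  {f | f ∈ smoothSpace F U ∧
    ∀ K : Set E, IsCompact K → K ⊆ U → ∀ l : ℝ, 0 < l → supNorm (W l) K f < ∞}

/-- Restriction of functions of Roumieu type to a relatively compact open subset. -/
def roumieuRestrict (W : ℝ → ℕ → ℝ) {U V : Opens E} (h : RelCompact V U)
    (f : roumieuSet F W U) : unionSpace F W V :=
  ⟨(V : Set E).indicator f.1, by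
    obtain ⟨l, hl, hfin⟩ := f.2.2 _ h.1 h.2
    exact stepSpace_le_unionSpace W V hl (restrict_mem (W l) h f.2.1 hfin)⟩

/-- Restriction of functions of Beurling type to a relatively compact open subset. -/
def beurlingRestrict (W : ℝ → ℕ → ℝ) {U V : Opens E} (h : RelCompact V U) {l : ℝ} (hl : 0 < l)
    (f : beurlingSet F W U) : stepSpace F (W l) V :=
  ⟨(V : Set E).indicator f.1, restrict_mem (W l) h f.2.1 (f.2.2 _ h.1 h.2 l hl)⟩

/-- The Roumieu space of a family `W` of weight sequences, with the topology of the projective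
limit over `V` relatively compact in `U` of the inductive limits over `l > 0`. -/
def roumieuSpace (F : Type*) [NormedAddCommGroup F] [NormedSpace ℝ F] (W : ℝ → ℕ → ℝ)
    (U : Opens E) : FunctionSpace E F where
  carrier := roumieuSet F W U
  topology := ⨅ (V : Opens E) (h : RelCompact V U),
    (inductiveTopology F W V).induced (roumieuRestrict W h)

/-- The Beurling space of a family `W` of weight sequences, with the topology of the projective
limit over `V` relatively compact in `U` and over `l > 0`. -/
def beurlingSpace (F : Type*) [NormedAddCommGroup F] [NormedSpace ℝ F] (W : ℝ → ℕ → ℝ)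
    (U : Opens E) : FunctionSpace E F where
  carrier := beurlingSet F W U
  topology := ⨅ (V : Opens E) (h : RelCompact V U) (l : ℝ) (hl : 0 < l),
    (stepTopology F (W l) V).induced (beurlingRestrict W h hl)

/-- The two types of classes. -/
inductive ClassType
  | roumieu
  | beurling

/-- The Roumieu or the Beurling space of a family of weight sequences. -/
def ultraSpace (F : Type*) [NormedAddCommGroup F] [NormedSpace ℝ F] (T : ClassType)
    (W : ℝ → ℕ → ℝ) (U : Opens E) : FunctionSpace E F :=
  match T with
  | .roumieu => roumieuSpace F W U
  | .beurling => beurlingSpace F W U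

/-- `𝓔_{[M]}(U, F)`: the weights are `h^k M_k`, `h > 0`. -/
def seqSpace (F : Type*) [NormedAddCommGroup F] [NormedSpace ℝ F] (T : ClassType)
    (M : ℕ → ℝ) (U : Opens E) : FunctionSpace E F :=
  ultraSpace F T (fun h k => h ^ k * M k) U

/-- `𝓔_{[ω]}(U, F)`: the weights are `exp ((1/l) φ*_ω(l k))`, `l > 0`. -/
def funSpace (F : Type*) [NormedAddCommGroup F] [NormedSpace ℝ F] (T : ClassType)
    (ω : ℝ → ℝ) (U : Opens E) : FunctionSpace E F :=
  ultraSpace F T (fun l => assocSeq ω l) U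

end Ultra

end

/-! Everything rests on Legendre duality between `log M` and `ω_M`. The sequence `p ↦ log M p` is
convex, so the supremum defining `ω_M` is attained at index `p` when `t = μ_p`; hence `φ*_{ω_M}(p) =
log M p`, that is `N^1 = M` (`IsLC.assocSeq_one`).

The two hypotheses dualize separately. From (mg) comes `(ω₆)`, whose dual `φ*(2x) ≤ 2 φ*(x) + H x +
H` says that doubling `l` changes `N^l` only by a geometric factor; as `N^l` grows with `l`, all
`N^l` are equivalent, in particular to `N^1 = M` (`IsW0.seqLE_assocSeq`). From `(β₃)` comes `ω_M(2t)
= O(ω_M(t))`, whose dual `a x + φ*(x) ≤ φ*(L x) / L + 1` says that a factor `h ^ k` is absorbed by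
passing from `l` to `L l` (`IsW.weightLE_assocSeq`). Together the weight families of `ω_M` and of a
single `N^l` dominate each other, so that the spaces and their topologies agree (`ultraSpace_eq`).

The other assertions are transfers along `M ≈ N^l`. The delicate one is `(β₃)`: under (mg) the
quotients are comparable to the roots, so equivalent sequences have comparable quotients, and
iterating `(β₃)` makes the gap larger than the constants lost. -/

namespace Ultra

/-! ### Comparison of spaces under domination of their weights -/

section Spaces

variable {E F : Type*} [NormedAddCommGroup E] [NormedSpace ℝ E]
  [NormedAddCommGroup F] [NormedSpace ℝ F]

/-- Two function spaces with the same functions coincide as soon as both identity maps are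
continuous. -/
theorem FunctionSpace.ext_of_continuous {X Y : Type*} {A B : FunctionSpace X Y}
    (hAB : A.carrier ⊆ B.carrier) (hBA : B.carrier ⊆ A.carrier)
    (h₁ : @Continuous _ _ A.topology B.topology (Set.inclusion hAB))
    (h₂ : @Continuous _ _ B.topology A.topology (Set.inclusion hBA)) : A = B := by
  obtain ⟨a, s⟩ := A
  obtain ⟨b, t⟩ := B
  obtain rfl : a = b := hAB.antisymm hBA
  congr 1
  exact le_antisymm (continuous_id_iff_le.1 h₁) (continuous_id_iff_le.1 h₂)

/-- `v ≤ C w` for some constant `C`. -/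
def WeightLE (v w : ℕ → ℝ) : Prop := ∃ C : ℝ, 0 < C ∧ ∀ k, v k ≤ C * w k

theorem supNorm_le_of_weight_le {v w : ℕ → ℝ} (hv : ∀ k, 0 < v k) (hw : ∀ k, 0 < w k) {C : ℝ}
    (hC : 0 < C) (h : ∀ k, v k ≤ C * w k) (K : Set E) (f : E → F) :
    supNorm w K f ≤ ENNReal.ofReal C * supNorm v K f := by
  refine iSup_le fun k => iSup₂_le fun x hx => ?_
  refine le_trans ?_ (mul_le_mul_right (le_supNorm v f k hx) _)
  rw [← ENNReal.ofReal_mul hC.le]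
  refine ENNReal.ofReal_le_ofReal ?_
  rw [mul_div_assoc', div_le_div_iff₀ (hw k) (hv k)]
  nlinarith [mul_le_mul_of_nonneg_left (h k) (norm_nonneg (iteratedFDeriv ℝ k f x))]

theorem WeightLE.supNorm_lt_top {v w : ℕ → ℝ} (hv : ∀ k, 0 < v k) (hw : ∀ k, 0 < w k)
    (h : WeightLE v w) {K : Set E} {f : E → F} (hf : supNorm v K f < ∞) :
    supNorm w K f < ∞ := by
  obtain ⟨C, hC, h⟩ := h
  exact (supNorm_le_of_weight_le hv hw hC h K f).trans_lt
    (ENNReal.mul_lt_top ENNReal.ofReal_lt_top hf)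

theorem WeightLE.stepSpace_le {v w : ℕ → ℝ} (hv : ∀ k, 0 < v k) (hw : ∀ k, 0 < w k)
    (h : WeightLE v w) (V : Opens E) : stepSpace F v V ≤ stepSpace F w V :=
  fun _ hf => ⟨hf.1, h.supNorm_lt_top hv hw hf.2⟩

theorem stepNorm_apply (w : ℕ → ℝ) (V : Opens E) (f : stepSpace F w V) :
    stepNorm F w V f = (supNorm w (V : Set E) (f : E → F)).toReal := rfl

theorem continuous_of_seminorm_le {X Y : Type*} [AddCommGroup X] [Module ℝ X] [AddCommGroup Y]
    [Module ℝ Y] (p : Seminorm ℝ X) (q : Seminorm ℝ Y) (f : X →ₗ[ℝ] Y) (C : ℝ)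
    (h : ∀ x, q (f x) ≤ C * p x) :
    @Continuous _ _ p.toSeminormedAddCommGroup.toUniformSpace.toTopologicalSpace
      q.toSeminormedAddCommGroup.toUniformSpace.toTopologicalSpace f := by
  let _ := p.toSeminormedAddCommGroup
  let _ := q.toSeminormedAddCommGroup
  exact AddMonoidHomClass.continuous_of_bound f C h

theorem WeightLE.continuous_inclusion {v w : ℕ → ℝ} (hv : ∀ k, 0 < v k) (hw : ∀ k, 0 < w k)
    (h : WeightLE v w) (V : Opens E) :
    @Continuous _ _ (stepTopology F v V) (stepTopology F w V)
      (Submodule.inclusion (h.stepSpace_le (F := F) hv hw V)) := by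
  have hle := h.stepSpace_le (F := F) hv hw V
  obtain ⟨C, hC, h⟩ := h
  refine continuous_of_seminorm_le (stepNorm F v V) (stepNorm F w V) _ C fun f => ?_
  rw [stepNorm_apply, stepNorm_apply, Submodule.coe_inclusion]
  have := ENNReal.toReal_mono (ENNReal.mul_lt_top ENNReal.ofReal_lt_top f.2.2).ne
    (supNorm_le_of_weight_le hv hw hC h (V : Set E) (f : E → F))
  rwa [ENNReal.toReal_mul, ENNReal.toReal_ofReal hC.le] at this

/-- Domination of families of weights, Roumieu type. -/
def RoumieuLE (W W' : ℝ → ℕ → ℝ) : Prop := ∀ l, 0 < l → ∃ l', 0 < l' ∧ WeightLE (W l) (W' l')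

/-- Domination of families of weights, Beurling type. -/
def BeurlingLE (W W' : ℝ → ℕ → ℝ) : Prop := ∀ l, 0 < l → ∃ l', 0 < l' ∧ WeightLE (W l') (W' l)

/-- All the weights of the family are positive. -/
def PosWeights (W : ℝ → ℕ → ℝ) : Prop := ∀ l, 0 < l → ∀ k, 0 < W l k

variable {W W' : ℝ → ℕ → ℝ}

theorem roumieuSet_subset (hW : PosWeights W) (hW' : PosWeights W') (h : RoumieuLE W W')
    (U : Opens E) : roumieuSet F W U ⊆ roumieuSet F W' U := by
  rintro f ⟨hf, hK⟩
  refine ⟨hf, fun K hc hKU => ?_⟩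
  obtain ⟨l, hl, hfin⟩ := hK K hc hKU
  obtain ⟨l', hl', hle⟩ := h l hl
  exact ⟨l', hl', hle.supNorm_lt_top (hW l hl) (hW' l' hl') hfin⟩

theorem beurlingSet_subset (hW : PosWeights W) (hW' : PosWeights W') (h : BeurlingLE W W')
    (U : Opens E) : beurlingSet F W U ⊆ beurlingSet F W' U := by
  rintro f ⟨hf, hK⟩
  refine ⟨hf, fun K hc hKU l hl => ?_⟩
  obtain ⟨l', hl', hle⟩ := h l hl
  exact hle.supNorm_lt_top (hW l' hl') (hW' l hl) (hK K hc hKU l' hl')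

theorem unionSpace_le (hW : PosWeights W) (hW' : PosWeights W') (h : RoumieuLE W W')
    (V : Opens E) : unionSpace F W V ≤ unionSpace F W' V := by
  refine iSup₂_le fun l hl => ?_
  obtain ⟨l', hl', hle⟩ := h l hl
  exact (hle.stepSpace_le (hW l hl) (hW' l' hl') V).trans (stepSpace_le_unionSpace W' V hl')

/-- Each of the four conditions is stable under infima of topologies, so the infimum of the
admissible topologies is itself admissible. -/
theorem inductiveTopology_mem (W : ℝ → ℕ → ℝ) (V : Opens E) :
    @IsTopologicalAddGroup (unionSpace F W V) (inductiveTopology F W V) _ ∧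
    @ContinuousSMul ℝ (unionSpace F W V) _ _ (inductiveTopology F W V) ∧
    @LocallyConvexSpace ℝ (unionSpace F W V) _ _ _ _ (inductiveTopology F W V) ∧
    ∀ (l : ℝ) (hl : 0 < l), @Continuous _ _ (stepTopology F (W l) V) (inductiveTopology F W V)
      (Submodule.inclusion (stepSpace_le_unionSpace W V hl)) :=
  ⟨topologicalAddGroup_sInf fun _ ht => ht.1, continuousSMul_sInf fun _ ht => ht.2.1,
    LocallyConvexSpace.sInf fun _ ht => ht.2.2.1,
    fun l hl => continuous_sInf_rng.2 fun _ ht => ht.2.2.2 l hl⟩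

/-- The target topology pulled back along the inclusion is one of the competitors in the infimum
defining the source topology: each step of `W` maps continuously through a step of `W'`. -/
theorem continuous_unionSpace_inclusion (hW : PosWeights W) (hW' : PosWeights W')
    (h : RoumieuLE W W') (V : Opens E) :
    @Continuous _ _ (inductiveTopology F W V) (inductiveTopology F W' V)
      (Submodule.inclusion (unionSpace_le (F := F) hW hW' h V)) := by
  obtain ⟨h₁, h₂, h₃, h₄⟩ := inductiveTopology_mem (F := F) W' V
  let := inductiveTopology F W' V
  rw [continuous_iff_le_induced]
  refine sInf_le ⟨topologicalAddGroup_induced _, continuousSMul_induced _,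
    LocallyConvexSpace.induced (Submodule.inclusion (unionSpace_le (F := F) hW hW' h V)),
    fun l hl => ?_⟩
  obtain ⟨l', hl', hle⟩ := h l hl
  let := stepTopology F (W l) V
  let := stepTopology F (W' l') V
  exact continuous_induced_rng.2
    ((h₄ l' hl').comp (hle.continuous_inclusion (F := F) (hW l hl) (hW' l' hl') V))

theorem coe_roumieuRestrict {U V : Opens E} (hV : RelCompact V U) (f : roumieuSet F W U) :
    (roumieuRestrict W hV f : E → F) = (V : Set E).indicator f.1 := rfl

theorem coe_beurlingRestrict {U V : Opens E} (hV : RelCompact V U) {l : ℝ} (hl : 0 < l)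
    (f : beurlingSet F W U) :
    (beurlingRestrict W hV hl f : E → F) = (V : Set E).indicator f.1 := rfl

theorem roumieuRestrict_comp_inclusion (hW : PosWeights W) (hW' : PosWeights W')
    (h : RoumieuLE W W') {U V : Opens E} (hV : RelCompact V U) :
    roumieuRestrict W' hV ∘ Set.inclusion (roumieuSet_subset (F := F) hW hW' h U) =
      Submodule.inclusion (unionSpace_le (F := F) hW hW' h V) ∘ roumieuRestrict W hV := by
  refine funext fun f => Subtype.ext ?_
  exact (coe_roumieuRestrict hV _).trans
    ((congrArg _ (Set.coe_inclusion (roumieuSet_subset (F := F) hW hW' h U) f)).trans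
      ((Submodule.coe_inclusion _ _).trans (coe_roumieuRestrict hV f)).symm)

theorem beurlingRestrict_comp_inclusion (hW : PosWeights W) (hW' : PosWeights W')
    (h : BeurlingLE W W') {U V : Opens E} (hV : RelCompact V U) {l l' : ℝ} (hl : 0 < l)
    (hl' : 0 < l') (hle : WeightLE (W l') (W' l)) :
    beurlingRestrict W' hV hl ∘ Set.inclusion (beurlingSet_subset (F := F) hW hW' h U) =
      Submodule.inclusion (hle.stepSpace_le (F := F) (hW l' hl') (hW' l hl) V) ∘
        beurlingRestrict W hV hl' := by
  refine funext fun f => Subtype.ext ?_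
  exact (coe_beurlingRestrict hV hl _).trans
    ((congrArg _ (Set.coe_inclusion (beurlingSet_subset (F := F) hW hW' h U) f)).trans
      ((Submodule.coe_inclusion _ _).trans (coe_beurlingRestrict hV hl' f)).symm)

theorem continuous_roumieu_inclusion (hW : PosWeights W) (hW' : PosWeights W')
    (h : RoumieuLE W W') (U : Opens E) :
    @Continuous (roumieuSet F W U) (roumieuSet F W' U) (roumieuSpace F W U).topology
      (roumieuSpace F W' U).topology
      (Set.inclusion (roumieuSet_subset (F := F) hW hW' h U)) := by
  refine continuous_iInf_rng.2 fun V => continuous_iInf_rng.2 fun hV => ?_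
  refine continuous_iInf_dom (i := V) (continuous_iInf_dom (i := hV) ?_)
  let := inductiveTopology F W V
  let := inductiveTopology F W' V
  let := (inductiveTopology F W V).induced (roumieuRestrict W hV)
  refine continuous_induced_rng.2 ?_
  rw [roumieuRestrict_comp_inclusion hW hW' h hV]
  exact (continuous_unionSpace_inclusion hW hW' h V).comp
    (continuous_induced_dom (f := roumieuRestrict W hV))

theorem continuous_beurling_inclusion (hW : PosWeights W) (hW' : PosWeights W')
    (h : BeurlingLE W W') (U : Opens E) :
    @Continuous (beurlingSet F W U) (beurlingSet F W' U) (beurlingSpace F W U).topology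
      (beurlingSpace F W' U).topology
      (Set.inclusion (beurlingSet_subset (F := F) hW hW' h U)) := by
  refine continuous_iInf_rng.2 fun V => continuous_iInf_rng.2 fun hV =>
    continuous_iInf_rng.2 fun l => continuous_iInf_rng.2 fun hl => ?_
  -- The component `(V, l)` of the target limit is controlled by the component `(V, l')` of the
  -- source limit.
  obtain ⟨l', hl', hle⟩ := h l hl
  refine continuous_iInf_dom (i := V) (continuous_iInf_dom (i := hV)
    (continuous_iInf_dom (i := l') (continuous_iInf_dom (i := hl') ?_)))
  let := stepTopology F (W l') V
  let := stepTopology F (W' l) V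
  let := (stepTopology F (W l') V).induced (beurlingRestrict W hV hl')
  refine continuous_induced_rng.2 ?_
  rw [beurlingRestrict_comp_inclusion hW hW' h hV hl hl' hle]
  exact (hle.continuous_inclusion (hW l' hl') (hW' l hl) V).comp
    (continuous_induced_dom (f := beurlingRestrict W hV hl'))

/-- Families of weights that dominate each other in both senses define the same spaces. -/
theorem ultraSpace_eq (hW : PosWeights W) (hW' : PosWeights W')
    (hR : RoumieuLE W W') (hR' : RoumieuLE W' W) (hB : BeurlingLE W W') (hB' : BeurlingLE W' W)
    (T : ClassType) (U : Opens E) : ultraSpace F T W U = ultraSpace F T W' U := by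
  cases T
  · exact FunctionSpace.ext_of_continuous (roumieuSet_subset hW hW' hR U)
      (roumieuSet_subset hW' hW hR' U) (continuous_roumieu_inclusion hW hW' hR U)
      (continuous_roumieu_inclusion hW' hW hR' U)
  · exact FunctionSpace.ext_of_continuous (beurlingSet_subset hW hW' hB U)
      (beurlingSet_subset hW' hW hB' U) (continuous_beurling_inclusion hW hW' hB U)
      (continuous_beurling_inclusion hW' hW hB' U)

end Spaces

theorem posWeights_pow {M : ℕ → ℝ} (hM : ∀ k, 0 < M k) : PosWeights fun h k => h ^ k * M k :=
  fun _ hl k => mul_pos (pow_pos hl k) (hM k)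

/-! ### Log-convex sequences -/

/-- A convex sequence lies above each of its chords' prolongations. -/
theorem chord_le_of_monotone {a : ℕ → ℝ} (h : Monotone fun j => a (j + 1) - a j) (p q : ℕ) :
    a (p + 1) + ((q : ℝ) - (p + 1)) * (a (p + 1) - a p) ≤ a q := by
  rcases le_total (p + 1) q with hq | hq
  · induction q, hq using Nat.le_induction with
    | base => push_cast; linarith
    | succ q hq ih =>
      have := h (show p ≤ q by omega)
      push_cast at this ⊢
      linarith
  · induction hk : p + 1 - q generalizing q with
    | zero =>
      obtain rfl : q = p + 1 := by omega
      push_cast; linarith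
    | succ k ih =>
      have h₁ := ih (q + 1) (by omega) (by omega)
      have := h (show q ≤ p by omega)
      push_cast at this h₁ ⊢
      linarith

variable {M N : ℕ → ℝ}

theorem IsLC.log_quotSeq_succ (hM : IsLC M) (p : ℕ) :
    Real.log (quotSeq M (p + 1)) = Real.log (M (p + 1)) - Real.log (M p) :=
  Real.log_div (hM.pos _).ne' (hM.pos _).ne'

theorem IsLC.quotSeq_pos (hM : IsLC M) (p : ℕ) : 0 < quotSeq M p := by
  cases p with
  | zero => exact one_pos
  | succ p => exact div_pos (hM.pos _) (hM.pos _)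

theorem IsLC.monotone_log_sub (hM : IsLC M) :
    Monotone fun j => Real.log (M (j + 1)) - Real.log (M j) := by
  refine monotone_nat_of_le_succ fun j => ?_
  have h := Real.log_le_log (pow_pos (hM.pos (j + 1)) 2) (hM.logConvex j)
  rw [Real.log_pow, Real.log_mul (hM.pos _).ne' (hM.pos _).ne'] at h
  push_cast at h
  have h2 : j + 1 + 1 = j + 2 := rfl
  rw [h2]
  linarith

theorem IsLC.log_one_nonneg (hM : IsLC M) : 0 ≤ Real.log (M 1) := Real.log_nonneg hM.one_le

theorem IsLC.log_zero (hM : IsLC M) : Real.log (M 0) = 0 := by rw [hM.zero, Real.log_one]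

theorem IsLC.log_sub_nonneg (hM : IsLC M) (p : ℕ) :
    0 ≤ Real.log (M (p + 1)) - Real.log (M p) := by
  have := hM.monotone_log_sub (Nat.zero_le p)
  have h1 := hM.log_one_nonneg
  have h0 := hM.log_zero
  simp only [zero_add] at this
  linarith

theorem IsLC.monotone_log (hM : IsLC M) : Monotone fun p => Real.log (M p) :=
  monotone_nat_of_le_succ fun p => by linarith [hM.log_sub_nonneg p]

theorem IsLC.log_nonneg (hM : IsLC M) (p : ℕ) : 0 ≤ Real.log (M p) := by
  have := hM.monotone_log (Nat.zero_le p)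
  simp only [hM.log_zero] at this
  exact this

theorem IsLC.one_le_quotSeq (hM : IsLC M) (p : ℕ) : 1 ≤ quotSeq M p := by
  cases p with
  | zero => exact le_rfl
  | succ p =>
    have := hM.log_sub_nonneg p
    rw [← hM.log_quotSeq_succ] at this
    exact (Real.log_nonneg_iff (hM.quotSeq_pos _)).1 this

/-- Supporting line of the convex sequence `log M` at `p`, with slope `log μ_p`. Every later use of
log-convexity beyond monotonicity goes through it. -/
theorem IsLC.log_add_mul_le (hM : IsLC M) {p : ℕ} (hp : 1 ≤ p) (q : ℕ) :
    Real.log (M p) + ((q : ℝ) - p) * Real.log (quotSeq M p) ≤ Real.log (M q) := by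
  obtain ⟨p, rfl⟩ := Nat.exists_eq_add_of_le' hp
  rw [hM.log_quotSeq_succ]
  push_cast
  exact chord_le_of_monotone (a := fun p => Real.log (M p)) hM.monotone_log_sub p q

/-! ### The associated function -/

theorem IsLC.log_term (hM : IsLC M) {t : ℝ} (ht : 0 < t) (p : ℕ) :
    Real.log (t ^ p * M 0 / M p) = p * Real.log t - Real.log (M p) := by
  rw [hM.zero, mul_one, Real.log_div (pow_pos ht p).ne' (hM.pos p).ne', Real.log_pow]

theorem IsLC.eventually_pow_le (hM : IsLC M) {t : ℝ} (ht : 0 < t) :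
    ∀ᶠ p in atTop, t ^ p ≤ M p := by
  filter_upwards [hM.root_tendsto.eventually_ge_atTop t, eventually_ge_atTop 1] with p hp h1
  have := pow_le_pow_left₀ ht.le hp p
  rwa [rootSeq, one_div, Real.rpow_inv_natCast_pow (hM.pos p).le (by omega)] at this

/-- Since the roots of `M` tend to infinity, all but finitely many terms are nonpositive. -/
theorem IsLC.assocFinite (hM : IsLC M) : AssocFinite M := by
  intro t ht
  refine IsBoundedUnder.bddAbove_range ⟨0, ?_⟩
  rw [eventually_map]
  filter_upwards [hM.eventually_pow_le ht] with p hp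
  rw [hM.log_term ht, ← Real.log_pow]
  linarith [Real.log_le_log (pow_pos ht p) hp]

theorem IsLC.le_assocFun (hM : IsLC M) {t : ℝ} (ht : 0 < t) (p : ℕ) :
    p * Real.log t - Real.log (M p) ≤ assocFun M t := by
  rw [assocFun, if_neg ht.ne', ← hM.log_term ht]
  exact le_csSup (hM.assocFinite t ht) ⟨p, rfl⟩

theorem IsLC.assocFun_le (hM : IsLC M) {t B : ℝ} (ht : 0 < t)
    (h : ∀ p : ℕ, p * Real.log t - Real.log (M p) ≤ B) : assocFun M t ≤ B := by
  rw [assocFun, if_neg ht.ne']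
  refine csSup_le (Set.range_nonempty _) ?_
  rintro _ ⟨p, rfl⟩
  exact (hM.log_term ht p).trans_le (h p)

theorem IsLC.assocFun_nonneg (hM : IsLC M) {t : ℝ} (ht : 0 ≤ t) : 0 ≤ assocFun M t := by
  rcases ht.eq_or_lt with rfl | ht
  · simp [assocFun]
  · simpa [hM.log_zero] using hM.le_assocFun ht 0

theorem IsLC.assocFun_eq_zero (hM : IsLC M) {t : ℝ} (ht : t ∈ Set.Icc (0 : ℝ) 1) :
    assocFun M t = 0 := by
  rcases ht.1.eq_or_lt with rfl | h0
  · simp [assocFun]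
  · refine le_antisymm (hM.assocFun_le h0 fun p => ?_) (hM.assocFun_nonneg h0.le)
    have h1 := mul_nonpos_of_nonneg_of_nonpos (Nat.cast_nonneg (α := ℝ) p)
      (Real.log_nonpos h0.le ht.2)
    linarith [hM.log_nonneg p]

theorem IsLC.assocFun_mono (hM : IsLC M) {s t : ℝ} (hs : 0 ≤ s) (hst : s ≤ t) :
    assocFun M s ≤ assocFun M t := by
  rcases hs.eq_or_lt with rfl | h0
  · rw [hM.assocFun_eq_zero (by simp)]
    exact hM.assocFun_nonneg hst
  · refine hM.assocFun_le h0 fun p => (sub_le_sub_right ?_ _).trans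
      (hM.le_assocFun (h0.trans_le hst) p)
    exact mul_le_mul_of_nonneg_left (Real.log_le_log h0 hst) (Nat.cast_nonneg p)

/-- In the variable `log t`, `ω_M` is a supremum of affine functions. -/
theorem IsLC.convexOn_phi (hM : IsLC M) : ConvexOn ℝ Set.univ (phi (assocFun M)) := by
  refine ⟨convex_univ, fun x _ y _ a b ha hb hab => ?_⟩
  refine hM.assocFun_le (Real.exp_pos _) fun p => ?_
  have hx := hM.le_assocFun (Real.exp_pos x) p
  have hy := hM.le_assocFun (Real.exp_pos y) p
  rw [Real.log_exp] at hx hy ⊢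
  simp only [smul_eq_mul, phi]
  have h1 := mul_le_mul_of_nonneg_left hx ha
  have h2 := mul_le_mul_of_nonneg_left hy hb
  have h3 : Real.log (M p) = a * Real.log (M p) + b * Real.log (M p) := by
    rw [← add_mul, hab, one_mul]
  linarith

/-- A finite convex function on the line is continuous, which settles `t > 0`; near `0` the function
vanishes. -/
theorem IsLC.continuousOn_assocFun (hM : IsLC M) : ContinuousOn (assocFun M) (Set.Ici 0) := by
  have hphi : Continuous (phi (assocFun M)) :=
    continuousOn_univ.1 (hM.convexOn_phi.continuousOn isOpen_univ)
  intro t ht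
  rcases (show (0 : ℝ) ≤ t from ht).eq_or_lt with rfl | h0
  · refine (continuousWithinAt_const (b := (0 : ℝ))).congr_of_eventuallyEq ?_
      (hM.assocFun_eq_zero (by simp))
    filter_upwards [self_mem_nhdsWithin, mem_nhdsWithin_of_mem_nhds (Iio_mem_nhds one_pos)]
      with s hs hs1 using hM.assocFun_eq_zero ⟨hs, le_of_lt hs1⟩
  · refine ContinuousAt.continuousWithinAt ?_
    refine (hphi.continuousAt.comp (Real.continuousAt_log h0.ne')).congr ?_
    filter_upwards [lt_mem_nhds h0] with s hs
    simp [phi, Real.exp_log hs]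

theorem IsLC.isW0 (hM : IsLC M) : IsW0 (assocFun M) where
  nonneg _ := hM.assocFun_nonneg
  continuousOn := hM.continuousOn_assocFun
  monotoneOn _ hs _ _ hst := hM.assocFun_mono hs hst
  eq_zero _ := hM.assocFun_eq_zero
  tendsto := by
    refine tendsto_atTop_mono' atTop ?_
      (tendsto_atTop_add_const_right atTop (-Real.log (M 1)) Real.tendsto_log_atTop)
    filter_upwards [eventually_gt_atTop 0] with t ht
    simpa [sub_eq_add_neg] using hM.le_assocFun ht 1
  om3 := by
    refine isLittleO_iff.2 fun c hc => ?_
    -- The single term of index `p` gives `c ω_M(t) ≥ 2 log t - c log M p`; one of the two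
    -- logarithms pays for the constant.
    obtain ⟨p, hp⟩ := exists_nat_gt (2 / c)
    filter_upwards [eventually_ge_atTop 1,
      Real.tendsto_log_atTop.eventually_ge_atTop (c * Real.log (M p))] with t ht h1
    have h0 : 0 < t := by linarith
    have h2 := hM.le_assocFun h0 p
    have h3 := Real.log_nonneg ht
    rw [Real.norm_of_nonneg h3, Real.norm_of_nonneg (hM.assocFun_nonneg h0.le)]
    rw [div_lt_iff₀ hc] at hp
    nlinarith [mul_le_mul_of_nonneg_left h2 hc.le, mul_le_mul_of_nonneg_right hp.le h3]
  om4 := hM.convexOn_phi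

/-- By (mg) with `j = k = p`, the term of index `2p` at `C t` is at least twice the term of index
`p` at `t`. -/
theorem IsLC.om6 (hM : IsLC M) (hmg : ModerateGrowth M) : Om6 (assocFun M) := by
  obtain ⟨C, hC, h⟩ := hmg
  refine ⟨C, hC, fun t ht => ?_⟩
  have hC0 : 0 < C := by linarith
  rcases ht.eq_or_lt with rfl | h0
  · rw [mul_zero, hM.assocFun_eq_zero (by simp)]
    linarith
  · suffices assocFun M t ≤ assocFun M (C * t) / 2 by linarith
    refine hM.assocFun_le h0 fun p => ?_
    have h1 := hM.le_assocFun (mul_pos hC0 h0) (p + p)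
    have h2 := Real.log_le_log (hM.pos _) (h p p)
    rw [Real.log_mul (pow_pos hC0 _).ne' (mul_pos (hM.pos _) (hM.pos _)).ne',
      Real.log_mul (hM.pos _).ne' (hM.pos _).ne', Real.log_pow] at h2
    rw [Real.log_mul hC0.ne' h0.ne'] at h1
    push_cast at h1 h2
    linarith

/-! ### Condition `(β₃)` -/

/-- Replacing `Q` by `Q ^ k` raises the lower bound `a > 1` of the ratio to `a ^ k`, so any factor
is reached. -/
theorem Beta3.exists_mul_le (hM : IsLC M) (h : Beta3 M) (B : ℝ) :
    ∃ Q : ℕ, 0 < Q ∧ ∃ p₀ : ℕ, ∀ p, p₀ ≤ p → B * quotSeq M p ≤ quotSeq M (Q * p) := by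
  obtain ⟨Q, hQ, h⟩ := h
  obtain ⟨a, ha, h⟩ := EReal.lt_iff_exists_real_btwn.1 h
  have ha1 : 1 < a := by exact_mod_cast ha
  obtain ⟨p₀, hp₀⟩ := eventually_atTop.1 (eventually_lt_of_lt_liminf h)
  have key : ∀ k p, p₀ ≤ p → a ^ k * quotSeq M p ≤ quotSeq M (Q ^ k * p) := by
    intro k
    induction k with
    | zero => intro p _; simp
    | succ k ih =>
      intro p hp
      have h1 := hp₀ (Q ^ k * p) (hp.trans (Nat.le_mul_of_pos_left p (by positivity)))
      rw [EReal.coe_lt_coe_iff, lt_div_iff₀ (hM.quotSeq_pos _)] at h1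
      have h2 := mul_le_mul_of_nonneg_left (ih p hp) (by linarith : 0 ≤ a)
      rw [show Q ^ (k + 1) * p = Q * (Q ^ k * p) by ring, pow_succ]
      linarith
  obtain ⟨k, hk⟩ := pow_unbounded_of_one_lt B ha1
  refine ⟨Q ^ k, by positivity, p₀, fun p hp => ?_⟩
  exact (mul_le_mul_of_nonneg_right hk.le (hM.quotSeq_pos p).le).trans (key k p hp)

theorem Beta3.of_two_mul_le (hM : IsLC M) {Q : ℕ} (hQ : 0 < Q) {p₀ : ℕ}
    (h : ∀ p, p₀ ≤ p → 2 * quotSeq M p ≤ quotSeq M (Q * p)) : Beta3 M := by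
  refine ⟨Q, hQ, ?_⟩
  have h12 : (1 : EReal) < ((2 : ℝ) : EReal) := by exact_mod_cast one_lt_two
  refine h12.trans_le (le_liminf_of_le (by isBoundedDefault) ?_)
  filter_upwards [eventually_ge_atTop p₀] with p hp
  rw [EReal.coe_le_coe_iff, le_div_iff₀ (hM.quotSeq_pos _)]
  exact h p hp

/-- If `2 μ_p ≤ μ_{Qp}`, then by convexity a block of `Q` steps of `log M` from `Q p` gains at least
`Q (log 2 + log μ_p)`. Summed over blocks, this bounds a term of `ω_M(2t)` by `Q` times a term of
`ω_M(t)`, up to `O(log t)`, which is `O(ω_M)`. -/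
theorem Beta3.om1 (hM : IsLC M) (h : Beta3 M) :
    (fun t => assocFun M (2 * t)) =O[atTop] assocFun M := by
  obtain ⟨Q, hQ, p₀, hp₀⟩ := h.exists_mul_le hM 2
  -- Chosen to make `key` an equality at `p = p₀`.
  set c : ℝ := Real.log (M (Q * (p₀ + 1))) - Q * p₀ * Real.log 2 - Q * Real.log (M p₀) with hc
  have hQ0 : (0 : ℝ) ≤ Q := Nat.cast_nonneg Q
  have key : ∀ p, p₀ ≤ p →
      c + Q * p * Real.log 2 + Q * Real.log (M p) ≤ Real.log (M (Q * (p + 1))) := by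
    intro p hp
    induction p, hp using Nat.le_induction with
    | base => rw [hc]; linarith
    | succ p hp ih =>
      have h1 := hM.log_add_mul_le (p := Q * (p + 1)) (Nat.mul_pos hQ p.succ_pos) (Q * (p + 1 + 1))
      have h2 := Real.log_le_log (mul_pos two_pos (hM.quotSeq_pos (p + 1)))
        (hp₀ (p + 1) (by omega))
      rw [Real.log_mul two_ne_zero (hM.quotSeq_pos _).ne', hM.log_quotSeq_succ] at h2
      have h3 := mul_le_mul_of_nonneg_left h2 hQ0
      push_cast at h1 ⊢
      linarith
  have bound : ∀ t : ℝ, 1 ≤ t → assocFun M (2 * t) ≤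
      Q * assocFun M t + (Q * (p₀ + 2) * Real.log (2 * t) + |c|) := by
    intro t ht
    have h0 : 0 < t := by linarith
    have hlog : 0 ≤ Real.log (2 * t) := Real.log_nonneg (by linarith)
    have hpos := mul_nonneg hQ0 (hM.assocFun_nonneg h0.le)
    refine hM.assocFun_le (by linarith) fun n => ?_
    have hn := Nat.div_add_mod n Q
    have hr := Nat.mod_lt n hQ
    have hn1 : n ≤ Q * (n / Q + 1) := by rw [mul_add, mul_one]; omega
    have hn2 : (n : ℝ) ≤ Q * ((n / Q : ℕ) + 1) := by exact_mod_cast hn1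
    have hn3 := mul_le_mul_of_nonneg_right hn2 hlog
    -- Small `n` are paid for entirely by the logarithmic term. Otherwise `n / Q = p + 1`, and
    -- rounding `n` up to `Q (p + 2)` instead of `Q p` costs only `2 Q log (2t)`.
    rcases Nat.lt_or_ge (n / Q) (p₀ + 1) with hlt | hge
    · have h1 : ((n / Q : ℕ) : ℝ) ≤ p₀ + 1 := by exact_mod_cast hlt.le
      have h2 := mul_le_mul_of_nonneg_left h1 (mul_nonneg hQ0 hlog)
      linarith [hM.log_nonneg n, abs_nonneg c]
    · obtain ⟨p, hp⟩ := Nat.exists_eq_add_of_le' (show 1 ≤ n / Q by omega)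
      rw [hp] at hn3 hge hn
      have h1 := key p (by omega)
      have h2 := hM.monotone_log (show Q * (p + 1) ≤ n by omega)
      have h3 := mul_le_mul_of_nonneg_left (hM.le_assocFun h0 p) hQ0
      have h4 : Real.log (2 * t) = Real.log 2 + Real.log t := Real.log_mul two_ne_zero h0.ne'
      have h5 : 0 ≤ Q * p₀ * Real.log (2 * t) := by positivity
      have h6 : Q * p * Real.log (2 * t) = Q * p * Real.log 2 + Q * p * Real.log t := by
        rw [h4]; ring
      push_cast at hn3 h1 h2
      linarith [neg_abs_le c]
  have hW := hM.isW0
  have h1 : (fun t => Q * assocFun M t + (Q * (p₀ + 2) * Real.log (2 * t) + |c|))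
      =O[atTop] assocFun M := by
    have hconst : ∀ b : ℝ, (fun _ : ℝ => b) =O[atTop] assocFun M := fun b =>
      (isLittleO_const_left.2 (Or.inr (tendsto_abs_atTop_atTop.comp hW.tendsto))).isBigO
    have hl : (fun t => Real.log (2 * t)) =O[atTop] assocFun M := by
      refine ((hconst (Real.log 2)).add hW.om3.isBigO).congr' ?_ EventuallyEq.rfl
      filter_upwards [eventually_gt_atTop 0] with t ht
      rw [Real.log_mul two_ne_zero ht.ne']
    exact ((isBigO_refl _ _).const_mul_left _).add ((hl.const_mul_left _).add (hconst _))
  refine IsBigO.trans (IsBigO.of_bound 1 ?_) h1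
  filter_upwards [eventually_ge_atTop 1] with t ht
  rw [one_mul, Real.norm_of_nonneg (hM.assocFun_nonneg (by linarith))]
  exact (bound t ht).trans (le_abs_self _)

/-! ### Comparison of associated functions -/

/-- The geometric factor becomes a dilation of `t`, the constant factor an additive `log C₂`. -/
theorem SeqLE.assocFun_le (hM : IsLC M) (hN : IsLC N) (h : SeqLE M N) :
    ∃ C : ℝ, 1 ≤ C ∧ ∀ t, 0 < t → assocFun N t ≤ assocFun M (C * t) + C := by
  obtain ⟨C₁, C₂, h₁, h₂, h⟩ := h
  refine ⟨max C₁ C₂, le_max_of_le_left h₁, fun t ht => ?_⟩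
  have hC₁ : 0 < C₁ := by linarith
  have hC₂ : 0 < C₂ := by linarith
  have hm := hM.assocFun_mono (mul_pos hC₁ ht).le
    (mul_le_mul_of_nonneg_right (le_max_left C₁ C₂) ht.le)
  refine hN.assocFun_le ht fun p => ?_
  have h3 := hM.le_assocFun (mul_pos hC₁ ht) p
  have h4 := Real.log_le_log (hM.pos p) (h p)
  rw [Real.log_mul (mul_pos hC₂ (pow_pos hC₁ p)).ne' (hN.pos p).ne',
    Real.log_mul hC₂.ne' (pow_pos hC₁ p).ne', Real.log_pow] at h4
  rw [Real.log_mul hC₁.ne' ht.ne'] at h3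
  linarith [Real.log_le_sub_one_of_pos hC₂, le_max_right C₁ C₂]

/-! ### Weight functions and the Young conjugate -/

section WeightFunction

variable {ω : ℝ → ℝ}

theorem IsW0.phi_nonneg (hω : IsW0 ω) (y : ℝ) : 0 ≤ phi ω y := hω.nonneg _ (Real.exp_pos y).le

theorem IsW0.phi_zero (hω : IsW0 ω) : phi ω 0 = 0 := by
  rw [phi, Real.exp_zero]
  exact hω.eq_zero 1 (by simp)

theorem IsW0.conjFinite (hω : IsW0 ω) : ConjFinite ω := by
  intro x hx
  -- This choice gives `φ_ω(y) ≥ (x + 1) y` for large `y`, where the values are then nonpositive.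
  have h := hω.om3.bound (show 0 < 1 / (x + 1) by positivity)
  obtain ⟨y₀, hy₀⟩ := eventually_atTop.1 (Real.tendsto_exp_atTop.eventually h)
  refine ⟨x * |y₀|, ?_⟩
  rintro _ ⟨y, hy, rfl⟩
  change x * y - phi ω y ≤ x * |y₀|
  have hy0 : 0 ≤ y := hy
  have hxy := mul_nonneg hx (abs_nonneg y₀)
  rcases le_total y₀ y with hle | hle
  · have h1 := hy₀ y hle
    rw [Real.log_exp, Real.norm_of_nonneg hy0,
      Real.norm_of_nonneg (hω.nonneg _ (Real.exp_pos y).le), one_div_mul_eq_div, le_div_iff₀ (by linarith)] at h1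
    change y * (x + 1) ≤ phi ω y at h1
    linarith
  · have := mul_le_mul_of_nonneg_left (hle.trans (le_abs_self y₀)) hx
    linarith [hω.phi_nonneg y]

theorem IsW0.le_conj (hω : IsW0 ω) {x y : ℝ} (hx : 0 ≤ x) (hy : 0 ≤ y) :
    x * y - phi ω y ≤ conj ω x :=
  le_csSup (hω.conjFinite x hx) ⟨y, hy, rfl⟩

theorem conj_le {x B : ℝ} (h : ∀ y, 0 ≤ y → x * y - phi ω y ≤ B) : conj ω x ≤ B := by
  refine csSup_le (Set.Nonempty.image _ ⟨0, Set.self_mem_Ici⟩) ?_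
  rintro _ ⟨y, hy, rfl⟩
  exact h y hy

theorem IsW0.conj_nonneg (hω : IsW0 ω) {x : ℝ} (hx : 0 ≤ x) : 0 ≤ conj ω x := by
  simpa [hω.phi_zero] using hω.le_conj hx le_rfl

theorem IsW0.conj_zero (hω : IsW0 ω) : conj ω 0 = 0 :=
  le_antisymm (conj_le fun y _ => by linarith [hω.phi_nonneg y]) (hω.conj_nonneg le_rfl)

/-- Midpoint convexity of a supremum of affine functions; it becomes log-convexity of the associated
sequences. -/
theorem IsW0.two_mul_conj_le (hω : IsW0 ω) {x a b : ℝ} (ha : 0 ≤ a) (hb : 0 ≤ b)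
    (hx : 2 * x = a + b) : 2 * conj ω x ≤ conj ω a + conj ω b := by
  suffices conj ω x ≤ (conj ω a + conj ω b) / 2 by linarith
  refine conj_le fun y hy => ?_
  have h1 := hω.le_conj ha hy
  have h2 := hω.le_conj hb hy
  have h3 : 2 * (x * y) = a * y + b * y := by rw [← add_mul, ← hx, mul_assoc]
  linarith

/-- Because `φ_ω ≥ 0`, `c (x y - φ_ω(y)) ≤ c x y - φ_ω(y)`. This is what makes `assocSeq ω l`
increase with `l`. -/
theorem IsW0.mul_conj_le (hω : IsW0 ω) {x c : ℝ} (hx : 0 ≤ x) (hc : 1 ≤ c) :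
    c * conj ω x ≤ conj ω (c * x) := by
  have hc0 : 0 < c := by linarith
  rw [← le_div_iff₀' hc0]
  refine conj_le fun y hy => ?_
  rw [le_div_iff₀' hc0]
  have h1 := hω.le_conj (mul_nonneg hc0.le hx) hy
  nlinarith [hω.phi_nonneg y]

/-- Condition `(ω₆)` bounds the growth of the Young conjugate. -/
theorem IsW0.conj_two_mul_le (hω : IsW0 ω) (h6 : Om6 ω) :
    ∃ H : ℝ, 0 ≤ H ∧ ∀ x, 0 ≤ x → conj ω (2 * x) ≤ 2 * conj ω x + H * x + H := by
  obtain ⟨H, hH, h⟩ := h6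
  have hH0 : 0 < H := by linarith
  have hlog := Real.log_nonneg hH
  have hlog' := Real.log_le_sub_one_of_pos hH0
  refine ⟨2 * H, by linarith, fun x hx => conj_le fun y hy => ?_⟩
  have hxl := mul_le_mul_of_nonneg_left hlog' hx
  -- The test point `y - log H` turns the dilation in `(ω₆)` into a shift. When it would be
  -- negative, `y` is bounded and `2 x y` is at most a multiple of `x`.
  rcases le_total (Real.log H) y with hle | hle
  · have h1 := hω.le_conj hx (sub_nonneg.2 hle)
    have h2 := h (Real.exp (y - Real.log H)) (Real.exp_pos _).le
    rw [show H * Real.exp (y - Real.log H) = Real.exp y by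
      rw [Real.exp_sub, Real.exp_log hH0, mul_div_cancel₀ _ hH0.ne']] at h2
    change 2 * phi ω (y - Real.log H) ≤ phi ω y + H at h2
    linarith
  · have h1 := mul_le_mul_of_nonneg_left hle hx
    linarith [hω.phi_nonneg y, hω.conj_nonneg hx]

theorem IsW.exists_dilation_le (hω : IsW ω) {C : ℝ} (hC : 0 ≤ C) :
    ∃ L : ℝ, 1 ≤ L ∧ ∀ t, 0 ≤ t → ω (C * t) ≤ L * ω t + L := by
  obtain ⟨A, hA⟩ := hω.om1.bound
  obtain ⟨t₀, ht₀⟩ := eventually_atTop.1 hA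
  have h2 : ∃ L : ℝ, 1 ≤ L ∧ ∀ t, 0 ≤ t → ω (2 * t) ≤ L * ω t + L := by
    -- `|A|` serves the range `t ≥ t₀`; by monotonicity `ω (2 * |t₀|)` serves the rest.
    refine ⟨1 + |A| + ω (2 * |t₀|), ?_, fun t ht => ?_⟩
    · linarith [abs_nonneg A, hω.nonneg (2 * |t₀|) (by positivity)]
    · have hA0 := abs_nonneg A
      have hw := hω.nonneg (2 * |t₀|) (by positivity)
      have hwt := hω.nonneg t ht
      rcases le_total t₀ t with hle | hle
      · have h1 := ht₀ t hle
        rw [Real.norm_of_nonneg (hω.nonneg _ (by positivity)), Real.norm_of_nonneg hwt] at h1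
        nlinarith [mul_le_mul_of_nonneg_right (le_abs_self A) hwt, mul_nonneg hw hwt]
      · have h1 := hω.monotoneOn (show (0 : ℝ) ≤ 2 * t by positivity)
          (show (0 : ℝ) ≤ 2 * |t₀| by positivity)
          (mul_le_mul_of_nonneg_left (hle.trans (le_abs_self t₀)) zero_le_two)
        have h3 : 0 ≤ (1 + |A| + ω (2 * |t₀|)) * ω t := by positivity
        linarith
  obtain ⟨L, hL, h2⟩ := h2
  have hn : ∀ n : ℕ, ∃ K : ℝ, 1 ≤ K ∧ ∀ t, 0 ≤ t → ω (2 ^ n * t) ≤ K * ω t + K := by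
    intro n
    induction n with
    | zero =>
      refine ⟨1, le_rfl, fun t _ => ?_⟩
      rw [pow_zero, one_mul, one_mul]
      linarith
    | succ n ih =>
      obtain ⟨K, hK, ih⟩ := ih
      refine ⟨L * K + L, by nlinarith, fun t ht => ?_⟩
      have h1 := h2 (2 ^ n * t) (by positivity)
      have h3 := mul_le_mul_of_nonneg_left (ih t ht) (by linarith : 0 ≤ L)
      rw [show (2 : ℝ) ^ (n + 1) * t = 2 * (2 ^ n * t) by ring]
      nlinarith [mul_nonneg (by linarith : 0 ≤ L) (hω.nonneg t ht)]
  obtain ⟨n, hCn⟩ := pow_unbounded_of_one_lt |C| one_lt_two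
  obtain ⟨K, hK, h⟩ := hn n
  refine ⟨K, hK, fun t ht => ?_⟩
  exact (hω.monotoneOn (mul_nonneg hC ht) (show (0 : ℝ) ≤ 2 ^ n * t by positivity)
    (mul_le_mul_of_nonneg_right ((le_abs_self C).trans hCn.le) ht)).trans (h t ht)

/-- Dilation by `e^a` shifts `φ_ω`, so `φ_ω(a + y) ≤ L φ_ω(y) + L`; testing `φ*_ω(L x)` at `a + y`
yields the extra `a x`. -/
theorem IsW.exists_mul_add_conj_le (hω : IsW ω) {a : ℝ} (ha : 0 ≤ a) :
    ∃ L : ℝ, 1 ≤ L ∧ ∀ x, 0 ≤ x → a * x + conj ω x ≤ conj ω (L * x) / L + 1 := by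
  obtain ⟨L, hL, h⟩ := hω.exists_dilation_le (Real.exp_pos a).le
  have hL0 : 0 < L := by linarith
  refine ⟨L, hL, fun x hx => ?_⟩
  suffices conj ω x ≤ conj ω (L * x) / L + 1 - a * x by linarith
  refine conj_le fun y hy => ?_
  have h1 := hω.le_conj (mul_nonneg hL0.le hx) (add_nonneg ha hy)
  have h2 := h (Real.exp y) (Real.exp_pos y).le
  rw [← Real.exp_add] at h2
  change phi ω (a + y) ≤ L * phi ω y + L at h2
  have h3 : x * y - phi ω y + a * x - 1 ≤ conj ω (L * x) / L := by
    rw [le_div_iff₀' hL0]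
    linarith
  linarith

/-! ### The sequences associated with a weight function -/

theorem assocSeq_pos (ω : ℝ → ℝ) (l : ℝ) (p : ℕ) : 0 < assocSeq ω l p := Real.exp_pos _

theorem IsW0.isLC_assocSeq (hω : IsW0 ω) {l : ℝ} (hl : 0 < l) : IsLC (assocSeq ω l) where
  pos := assocSeq_pos ω l
  zero := by simp [assocSeq, hω.conj_zero]
  one_le := Real.one_le_exp (mul_nonneg (by positivity) (hω.conj_nonneg (by positivity)))
  logConvex j := by
    rw [assocSeq, assocSeq, assocSeq, ← Real.exp_add, ← Real.exp_nat_mul, Real.exp_le_exp]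
    have h := hω.two_mul_conj_le (x := l * (j + 1 : ℕ)) (a := l * j) (b := l * (j + 2 : ℕ))
      (by positivity) (by positivity) (by push_cast; ring)
    have := mul_le_mul_of_nonneg_left h (by positivity : 0 ≤ 1 / l)
    push_cast at this ⊢
    linarith
  root_tendsto := by
    have key : Tendsto (fun p : ℕ => 1 / l * conj ω (l * p) * (1 / (p : ℝ))) atTop atTop := by
      refine tendsto_atTop.2 fun B => ?_
      -- Testing the conjugate at `|B| + 1` leaves a surplus `l p`, which exceeds the fixed value
      -- `φ_ω(|B| + 1)` for large `p`.
      have hB : 0 ≤ |B| + 1 := by positivity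
      filter_upwards [(tendsto_natCast_atTop_atTop (R := ℝ)).eventually_ge_atTop
        (phi ω (|B| + 1) / l), eventually_gt_atTop 0] with p hp hp0
      have hp0' : (0 : ℝ) < p := by exact_mod_cast hp0
      rw [div_le_iff₀ hl] at hp
      have h1 := hω.le_conj (x := l * p) (by positivity) hB
      rw [one_div_mul_eq_div, mul_one_div, div_div, le_div_iff₀ (by positivity)]
      have := mul_le_mul_of_nonneg_left (le_abs_self B) (mul_pos hl hp0').le
      linarith
    refine (Real.tendsto_exp_atTop.comp key).congr fun p => ?_
    rw [Function.comp_apply, Real.exp_mul]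
    rfl

theorem SeqLE.refl (M : ℕ → ℝ) : SeqLE M M := ⟨1, 1, le_rfl, le_rfl, fun p => by simp⟩

theorem SeqLE.trans {M N P : ℕ → ℝ} (h : SeqLE M N) (h' : SeqLE N P) : SeqLE M P := by
  obtain ⟨C₁, C₂, h₁, h₂, h⟩ := h
  obtain ⟨D₁, D₂, h₁', h₂', h'⟩ := h'
  refine ⟨C₁ * D₁, C₂ * D₂, one_le_mul_of_one_le_of_one_le h₁ h₁',
    one_le_mul_of_one_le_of_one_le h₂ h₂', fun p => (h p).trans ?_⟩
  have := mul_le_mul_of_nonneg_left (h' p) (by positivity : 0 ≤ C₂ * C₁ ^ p)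
  rw [mul_pow]
  linarith

theorem IsW0.assocSeq_mono (hω : IsW0 ω) {l l' : ℝ} (hl : 0 < l) (h : l ≤ l') (p : ℕ) :
    assocSeq ω l p ≤ assocSeq ω l' p := by
  have hl' : 0 < l' := hl.trans_le h
  refine Real.exp_le_exp.2 ?_
  have h1 := hω.mul_conj_le (x := l * p) (by positivity) ((one_le_div hl).2 h)
  rw [show l' / l * (l * p) = l' * p by field_simp] at h1
  rw [one_div_mul_eq_div, one_div_mul_eq_div, le_div_iff₀ hl']
  calc conj ω (l * p) / l * l' = l' / l * conj ω (l * p) := by ring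
    _ ≤ _ := h1

theorem IsW0.seqLE_assocSeq_two_mul (hω : IsW0 ω) (h6 : Om6 ω) {l : ℝ} (hl : 0 < l) :
    SeqLE (assocSeq ω (2 * l)) (assocSeq ω l) := by
  obtain ⟨H, hH, h⟩ := hω.conj_two_mul_le h6
  refine ⟨Real.exp (H / 2), Real.exp (H / (2 * l)), Real.one_le_exp (by positivity),
    Real.one_le_exp (by positivity), fun p => ?_⟩
  rw [assocSeq, assocSeq, ← Real.exp_nat_mul, ← Real.exp_add, ← Real.exp_add, Real.exp_le_exp]
  have h1 := h (l * p) (by positivity)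
  rw [mul_assoc, one_div_mul_eq_div, div_le_iff₀ (by positivity)]
  refine h1.trans (le_of_eq ?_)
  field_simp
  ring

/-- Under `(ω₆)` all the sequences associated with `ω` are equivalent. -/
theorem IsW0.seqLE_assocSeq (hω : IsW0 ω) (h6 : Om6 ω) {l l' : ℝ} (hl : 0 < l) (hl' : 0 < l') :
    SeqLE (assocSeq ω l) (assocSeq ω l') := by
  have key : ∀ n : ℕ, SeqLE (assocSeq ω (2 ^ n * l')) (assocSeq ω l') := by
    intro n
    induction n with
    | zero => simpa using SeqLE.refl _
    | succ n ih =>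
      rw [show (2 : ℝ) ^ (n + 1) * l' = 2 * (2 ^ n * l') by ring]
      exact (hω.seqLE_assocSeq_two_mul h6 (by positivity)).trans ih
  obtain ⟨n, hn⟩ := pow_unbounded_of_one_lt (l / l') one_lt_two
  rw [div_lt_iff₀ hl'] at hn
  refine SeqLE.trans ⟨1, 1, le_rfl, le_rfl, fun p => ?_⟩ (key n)
  simpa using hω.assocSeq_mono hl hn.le p

/-- Apply the conjugate estimate with `a = log h`. That `L` is independent of `l` matters in the
Beurling case, where one starts from `l / L`. -/
theorem IsW.weightLE_assocSeq (hω : IsW ω) {h : ℝ} (hh : 1 ≤ h) : ∃ L : ℝ, 1 ≤ L ∧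
    ∀ l, 0 < l → WeightLE (fun k => h ^ k * assocSeq ω l k) (assocSeq ω (L * l)) := by
  obtain ⟨L, hL, hc⟩ := hω.exists_mul_add_conj_le (Real.log_nonneg hh)
  have hL0 : 0 < L := by linarith
  have hh0 : 0 < h := by linarith
  refine ⟨L, hL, fun l hl => ⟨Real.exp (1 / l), Real.exp_pos _, fun k => ?_⟩⟩
  simp only [assocSeq]
  rw [← Real.exp_log (pow_pos hh0 k), Real.log_pow, ← Real.exp_add, ← Real.exp_add,
    Real.exp_le_exp]
  have h1 := mul_le_mul_of_nonneg_left (hc (l * k) (by positivity)) (one_div_pos.2 hl).le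
  rw [← mul_assoc L] at h1
  refine (le_of_eq ?_).trans (h1.trans (le_of_eq ?_))
  · field_simp
  · field_simp
    ring

theorem posWeights_assocSeq (ω : ℝ → ℝ) : PosWeights (assocSeq ω) :=
  fun l _ k => assocSeq_pos ω l k

/-- Under `(ω₆)` the space defined by `ω` is defined by each single associated sequence. -/
theorem IsW.funSpace_eq_seqSpace (hω : IsW ω) (h6 : Om6 ω) {l : ℝ} (hl : 0 < l)
    {E F : Type*} [NormedAddCommGroup E] [NormedSpace ℝ E] [NormedAddCommGroup F]
    [NormedSpace ℝ F] (T : ClassType) (U : Opens E) :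
    funSpace F T ω U = seqSpace F T (assocSeq ω l) U := by
  refine ultraSpace_eq (posWeights_assocSeq ω) (posWeights_pow (assocSeq_pos ω l)) ?_ ?_ ?_ ?_ T U
  · intro l' hl'
    obtain ⟨C₁, C₂, h₁, h₂, h⟩ := hω.seqLE_assocSeq h6 hl' hl
    exact ⟨C₁, by linarith, C₂, by linarith, fun k => (h k).trans_eq (mul_assoc _ _ _)⟩
  · intro h hh
    obtain ⟨L, hL, hle⟩ := hω.weightLE_assocSeq (le_max_right h 1)
    obtain ⟨C, hC, hle⟩ := hle l hl
    refine ⟨L * l, by positivity, C, hC, fun k => le_trans ?_ (hle k)⟩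
    exact mul_le_mul_of_nonneg_right (pow_le_pow_left₀ hh.le (le_max_left h 1) k)
      (assocSeq_pos ω l k).le
  · intro h hh
    -- A small `h ^ k` on the dominating side is moved across as `(h⁻¹) ^ k` and absorbed between
    -- the indices `l / L` and `l`.
    obtain ⟨L, hL, hle⟩ := hω.weightLE_assocSeq (le_max_right h⁻¹ 1)
    have hL0 : 0 < L := by linarith
    obtain ⟨C, hC, hle⟩ := hle (l / L) (by positivity)
    rw [mul_div_cancel₀ _ hL0.ne'] at hle
    refine ⟨l / L, by positivity, C, hC, fun k => ?_⟩
    have h1 := (mul_le_mul_of_nonneg_right (pow_le_pow_left₀ (by positivity)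
      (le_max_left h⁻¹ 1) k) (assocSeq_pos ω (l / L) k).le).trans (hle k)
    rw [inv_pow, inv_mul_le_iff₀ (pow_pos hh k)] at h1
    linarith
  · intro l' hl'
    obtain ⟨C₁, C₂, h₁, h₂, h⟩ := hω.seqLE_assocSeq h6 hl hl'
    have hC₁ : 0 < C₁ := by linarith
    refine ⟨C₁⁻¹, by positivity, C₂, by linarith, fun k => ?_⟩
    simp only [inv_pow]
    rw [inv_mul_le_iff₀ (pow_pos hC₁ k)]
    linarith [h k]

end WeightFunction

/-! ### Transfer of conditions between equivalent sequences -/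

/-- A log-convex sequence is the first sequence associated with its associated function. -/
theorem IsLC.assocSeq_one (hM : IsLC M) : assocSeq (assocFun M) 1 = M := by
  funext p
  have hW := hM.isW0
  suffices conj (assocFun M) p = Real.log (M p) by
    rw [assocSeq, one_mul, this, div_one, one_mul, Real.exp_log (hM.pos p)]
  refine le_antisymm (conj_le fun y _ => ?_) ?_
  · have := hM.le_assocFun (Real.exp_pos y) p
    rw [Real.log_exp] at this
    rw [phi]
    linarith
  · rcases Nat.eq_zero_or_pos p with rfl | hp
    · rw [hM.log_zero, Nat.cast_zero, hW.conj_zero]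
    · have h1 := hW.le_conj (Nat.cast_nonneg p) (Real.log_nonneg (hM.one_le_quotSeq p))
      rw [phi, Real.exp_log (hM.quotSeq_pos p)] at h1
      have h2 := hM.assocFun_le (B := p * Real.log (quotSeq M p) - Real.log (M p))
        (hM.quotSeq_pos p) fun q => by linarith [hM.log_add_mul_le hp q]
      linarith

theorem isBigO_of_le_mul_add {σ τ : ℝ → ℝ} (hτ : Tendsto τ atTop atTop) {A B : ℝ}
    (h0 : ∀ t, 0 < t → 0 ≤ σ t) (h : ∀ t, 0 < t → σ t ≤ A * τ t + B) : σ =O[atTop] τ := by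
  have hB : (fun _ : ℝ => B) =O[atTop] τ :=
    (isLittleO_const_left.2 (Or.inr (tendsto_abs_atTop_atTop.comp hτ))).isBigO
  refine IsBigO.trans (IsBigO.of_bound 1 ?_) (((isBigO_refl τ _).const_mul_left A).add hB)
  filter_upwards [eventually_gt_atTop 0] with t ht
  rw [one_mul, Real.norm_of_nonneg (h0 t ht)]
  exact (h t ht).trans (le_abs_self _)

/-- Equivalent sequences have associated functions comparable up to a dilation, and the doubling
property of `ω_M` alone removes it in both directions. -/
theorem SeqEquiv.funEquiv (hM : IsLC M) (hN : IsLC N) (hW : IsW (assocFun M))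
    (h : SeqEquiv M N) : FunEquiv (assocFun N) (assocFun M) := by
  constructor
  · obtain ⟨C, hC, h⟩ := h.2.assocFun_le hN hM
    have hC0 : 0 < C := by linarith
    obtain ⟨L, hL, hd⟩ := hW.exists_dilation_le (by linarith : 0 ≤ C)
    refine isBigO_of_le_mul_add (A := L) (B := L * C + L) hN.isW0.tendsto
      (fun t ht => hM.assocFun_nonneg ht.le) fun t ht => ?_
    -- Here the dilation falls on `N`; evaluating at `t / C` moves it to `ω_M`.
    have h1 := h (t / C) (by positivity)
    have h2 := hd (t / C) (by positivity)
    rw [mul_div_cancel₀ _ hC0.ne'] at h1 h2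
    have := mul_le_mul_of_nonneg_left h1 (by linarith : 0 ≤ L)
    linarith
  · obtain ⟨C, hC, h⟩ := h.1.assocFun_le hM hN
    obtain ⟨L, hL, hd⟩ := hW.exists_dilation_le (by linarith : 0 ≤ C)
    refine isBigO_of_le_mul_add (A := L) (B := L + C) hM.isW0.tendsto
      (fun t ht => hN.assocFun_nonneg ht.le) fun t ht => ?_
    linarith [h t ht, hd t ht.le]

theorem FunEquiv.isW (hN : IsLC N) (hW : IsW (assocFun M))
    (h : FunEquiv (assocFun N) (assocFun M)) : IsW (assocFun N) where
  toIsW0 := hN.isW0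
  om1 := by
    have h2 : Tendsto (fun t : ℝ => 2 * t) atTop atTop :=
      tendsto_id.const_mul_atTop two_pos
    exact ((h.2.comp_tendsto h2).trans hW.om1).trans h.1

theorem SeqEquiv.moderateGrowth (hM : IsLC M) (hN : IsLC N) (h : SeqEquiv M N)
    (hmg : ModerateGrowth M) : ModerateGrowth N := by
  obtain ⟨⟨C₁, C₂, h₁, h₂, h⟩, ⟨D₁, D₂, h₁', h₂', h'⟩⟩ := h
  obtain ⟨C, hC, hmg⟩ := hmg
  have hB : 1 ≤ D₂ * C₂ * C₂ := one_le_mul_of_one_le_of_one_le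
    (one_le_mul_of_one_le_of_one_le h₂' h₂) h₂
  have hA : 1 ≤ D₁ * C * C₁ := one_le_mul_of_one_le_of_one_le
    (one_le_mul_of_one_le_of_one_le h₁' hC) h₁
  refine ⟨D₂ * C₂ * C₂ * (D₁ * C * C₁), one_le_mul_of_one_le_of_one_le hB hA, fun j k => ?_⟩
  have hNN := mul_pos (hN.pos j) (hN.pos k)
  -- (mg) allows no constant prefactor; `D₂ * C₂ * C₂` fits under the power only when `j + k ≥ 1`.
  rcases Nat.eq_zero_or_pos (j + k) with h0 | h0
  · obtain ⟨rfl, rfl⟩ : j = 0 ∧ k = 0 := by omega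
    simp [hN.zero]
  · have hD : 0 ≤ D₂ * D₁ ^ (j + k) := by positivity
    have e₁ := mul_le_mul (h j) (h k) (hM.pos k).le
      (mul_nonneg (by positivity) (hN.pos j).le)
    have e₂ := mul_le_mul_of_nonneg_left e₁ (by positivity : 0 ≤ C ^ (j + k))
    have e₃ := mul_le_mul_of_nonneg_left ((hmg j k).trans e₂) hD
    refine (h' (j + k)).trans (e₃.trans ?_)
    have e₄ : D₂ * C₂ * C₂ ≤ (D₂ * C₂ * C₂) ^ (j + k) := le_self_pow₀ hB h0.ne'
    have e₅ := mul_le_mul_of_nonneg_right e₄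
      (by positivity : 0 ≤ (D₁ * C * C₁) ^ (j + k) * (N j * N k))
    refine (le_of_eq ?_).trans (e₅.trans (le_of_eq ?_))
    · rw [mul_pow, mul_pow, pow_add C₁]; ring
    · rw [mul_pow (D₂ * C₂ * C₂)]; ring

/-- Under moderate growth the quotients are controlled by the roots. -/
theorem ModerateGrowth.mul_log_quotSeq_le (hM : IsLC M) (h : ModerateGrowth M) :
    ∃ c : ℝ, ∀ p : ℕ, 1 ≤ p → p * Real.log (quotSeq M p) ≤ c * p + Real.log (M p) := by
  obtain ⟨C, hC, h⟩ := h
  have hC0 : 0 < C := by linarith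
  refine ⟨2 * Real.log C, fun p hp => ?_⟩
  -- The supporting line at `2p` bounds `p log μ_p` by `log M_{2p} - log M_p`, which (mg) controls.
  have h1 := hM.log_add_mul_le hp (p + p)
  have h2 := Real.log_le_log (hM.pos _) (h p p)
  rw [Real.log_mul (pow_pos hC0 _).ne' (mul_pos (hM.pos _) (hM.pos _)).ne',
    Real.log_mul (hM.pos _).ne' (hM.pos _).ne', Real.log_pow] at h2
  push_cast at h1 h2
  linarith

/-- Up to constants the quotient of `M` is at most `(M p)^{1/p}` by (mg), which is at most `(N
p)^{1/p}`, and this is at most the quotient of `N` by log-convexity. -/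
theorem SeqLE.quotSeq_le (hM : IsLC M) (hN : IsLC N) (h : SeqLE M N) (hmg : ModerateGrowth M) :
    ∃ A : ℝ, 0 < A ∧ ∀ p : ℕ, 1 ≤ p → quotSeq M p ≤ A * quotSeq N p := by
  obtain ⟨C₁, C₂, h₁, h₂, h⟩ := h
  obtain ⟨c, hc⟩ := hmg.mul_log_quotSeq_le hM
  have hC₁ : 0 < C₁ := by linarith
  have hC₂ : 0 < C₂ := by linarith
  refine ⟨Real.exp (c + Real.log C₁ + Real.log C₂), Real.exp_pos _, fun p hp => ?_⟩
  have hp0 : (0 : ℝ) < p := by exact_mod_cast hp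
  have hp1 : (1 : ℝ) ≤ p := by exact_mod_cast hp
  rw [← Real.log_le_log_iff (hM.quotSeq_pos p)
    (mul_pos (Real.exp_pos _) (hN.quotSeq_pos p)), Real.log_mul (Real.exp_pos _).ne'
    (hN.quotSeq_pos p).ne', Real.log_exp]
  have h3 := hN.log_add_mul_le hp 0
  have h4 := Real.log_le_log (hM.pos p) (h p)
  rw [Real.log_mul (mul_pos hC₂ (pow_pos hC₁ p)).ne' (hN.pos p).ne',
    Real.log_mul hC₂.ne' (pow_pos hC₁ p).ne', Real.log_pow] at h4
  rw [hN.log_zero, Nat.cast_zero] at h3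
  have h5 := mul_le_mul_of_nonneg_right hp1 (Real.log_nonneg h₂)
  have h6 := hc p hp
  refine le_of_mul_le_mul_left ?_ hp0
  linarith

/-- Passing from `N` to `M` and back costs the factor `A * B`, so the iterated `(β₃)` is used with
`2 * A * B`. -/
theorem SeqEquiv.beta3 (hM : IsLC M) (hN : IsLC N) (h : SeqEquiv M N) (hmgM : ModerateGrowth M)
    (hmgN : ModerateGrowth N) (hβ : Beta3 M) : Beta3 N := by
  obtain ⟨A, hA, hMN⟩ := h.1.quotSeq_le hM hN hmgM
  obtain ⟨B, hB, hNM⟩ := h.2.quotSeq_le hN hM hmgN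
  obtain ⟨Q, hQ, p₀, hp₀⟩ := hβ.exists_mul_le hM (2 * A * B)
  refine Beta3.of_two_mul_le hN hQ (p₀ := p₀ + 1) fun p hp => ?_
  have h1 := hp₀ p (by omega)
  have h2 := hMN (Q * p) (Nat.mul_pos hQ (by omega))
  have h3 := mul_le_mul_of_nonneg_left (hNM p (by omega)) (by positivity : 0 ≤ 2 * A)
  refine le_of_mul_le_mul_left ?_ hA
  linarith

/-! ### Comparison with factorials, `(ω₂)` and `(ω₅)` -/

theorem SeqLE.rootSeq_le (hM : IsLC M) (hN : IsLC N) (h : SeqLE M N) :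
    ∃ C : ℝ, 0 < C ∧ ∀ p : ℕ, 1 ≤ p →
      rootSeq (divFact M) p ≤ C * rootSeq (divFact N) p := by
  obtain ⟨C₁, C₂, h₁, h₂, h⟩ := h
  have hC₁ : 0 < C₁ := by linarith
  have hC₂ : 0 < C₂ := by linarith
  refine ⟨C₂ * C₁, by positivity, fun p hp => ?_⟩
  have hp0 : p ≠ 0 := by omega
  have hf : (0 : ℝ) < p ! := by exact_mod_cast Nat.factorial_pos p
  have hM0 : 0 ≤ divFact M p := div_nonneg (hM.pos p).le hf.le
  have hN0 : 0 ≤ divFact N p := div_nonneg (hN.pos p).le hf.le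
  have h3 : divFact M p ≤ (C₂ * C₁) ^ p * divFact N p := by
    rw [divFact, divFact, mul_div_assoc']
    refine div_le_div_of_nonneg_right ((h p).trans ?_) hf.le
    rw [mul_pow]
    exact mul_le_mul_of_nonneg_right (mul_le_mul_of_nonneg_right (le_self_pow₀ h₂ hp0)
      (by positivity)) (hN.pos p).le
  rw [rootSeq, rootSeq, one_div]
  refine (Real.rpow_le_rpow hM0 h3 (by positivity)).trans (le_of_eq ?_)
  rw [Real.mul_rpow (by positivity) hN0, Real.pow_rpow_inv_natCast (by positivity) hp0]

theorem LiminfRootPos.exists_lt (h : LiminfRootPos M) :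
    ∃ ε : ℝ, 0 < ε ∧ ∀ᶠ p in atTop, ε ≤ rootSeq (divFact M) p := by
  obtain ⟨ε, hε, h⟩ := EReal.lt_iff_exists_real_btwn.1 h
  refine ⟨ε, by exact_mod_cast hε, ?_⟩
  filter_upwards [eventually_lt_of_lt_liminf h] with p hp
  exact le_of_lt (by exact_mod_cast hp)

theorem SeqLE.liminfRootPos (hM : IsLC M) (hN : IsLC N) (h : SeqLE M N)
    (hl : LiminfRootPos M) : LiminfRootPos N := by
  obtain ⟨C, hC, h⟩ := h.rootSeq_le hM hN
  obtain ⟨ε, hε, hl⟩ := hl.exists_lt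
  have h0 : (0 : EReal) < ((ε / C : ℝ) : EReal) := by exact_mod_cast div_pos hε hC
  refine h0.trans_le (le_liminf_of_le (by isBoundedDefault) ?_)
  filter_upwards [hl, eventually_ge_atTop 1] with p hp h1
  rw [EReal.coe_le_coe_iff, div_le_iff₀' hC]
  exact hp.trans (h p h1)

theorem SeqLE.limRootTop (hM : IsLC M) (hN : IsLC N) (h : SeqLE M N)
    (hl : LimRootTop M) : LimRootTop N := by
  obtain ⟨C, hC, h⟩ := h.rootSeq_le hM hN
  refine tendsto_atTop.2 fun B => ?_
  filter_upwards [hl.eventually_ge_atTop (C * B), eventually_ge_atTop 1] with p hp h1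
  exact le_of_mul_le_mul_left (hp.trans (h p h1)) hC

/-- Where `M p ≥ ε ^ p * p !`, one has `t ^ p / M p ≤ (t / ε) ^ p / p ! ≤ exp (t / ε)`; the finitely
many other indices contribute at most `p₀ log t`. -/
theorem IsLC.assocFun_le_div_add (hM : IsLC M) {ε : ℝ} (hε : 0 < ε)
    (h : ∀ᶠ p in atTop, ε ≤ rootSeq (divFact M) p) :
    ∃ K : ℝ, 0 ≤ K ∧ ∀ t, 1 ≤ t → assocFun M t ≤ t / ε + K * Real.log t := by
  obtain ⟨p₀, hp₀⟩ := eventually_atTop.1 h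
  refine ⟨p₀, Nat.cast_nonneg _, fun t ht => ?_⟩
  have h0 : 0 < t := by linarith
  have hlog := Real.log_nonneg ht
  have hdiv : 0 ≤ t / ε := by positivity
  refine hM.assocFun_le h0 fun p => ?_
  rcases Nat.lt_or_ge p (p₀ + 1) with hp | hp
  · have h1 : (p : ℝ) ≤ p₀ := by exact_mod_cast Nat.lt_succ_iff.1 hp
    have := mul_le_mul_of_nonneg_right h1 hlog
    linarith [hM.log_nonneg p]
  · have hf : (0 : ℝ) < p ! := by exact_mod_cast Nat.factorial_pos p
    have h1 := pow_le_pow_left₀ hε.le (hp₀ p (by omega)) p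
    rw [rootSeq, one_div, divFact,
      Real.rpow_inv_natCast_pow (div_nonneg (hM.pos p).le hf.le) (by omega), le_div_iff₀ hf] at h1
    have h2 := Real.pow_div_factorial_le_exp (t / ε) hdiv p
    have h3 : t ^ p ≤ Real.exp (t / ε) * M p := by
      rw [div_pow, div_div, div_le_iff₀ (by positivity)] at h2
      exact h2.trans (mul_le_mul_of_nonneg_left h1 (Real.exp_pos _).le)
    have h4 := Real.log_le_log (pow_pos h0 p) h3
    rw [Real.log_pow, Real.log_mul (Real.exp_pos _).ne' (hM.pos p).ne', Real.log_exp] at h4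
    have : 0 ≤ (p₀ : ℝ) * Real.log t := by positivity
    linarith

theorem LiminfRootPos.om2 (hM : IsLC M) (h : LiminfRootPos M) : Om2 (assocFun M) := by
  obtain ⟨ε, hε, h⟩ := h.exists_lt
  obtain ⟨K, hK, h⟩ := hM.assocFun_le_div_add hε h
  refine IsBigO.of_bound (1 / ε + K) ?_
  filter_upwards [eventually_ge_atTop 1] with t ht
  have h0 : 0 < t := by linarith
  rw [Real.norm_of_nonneg (hM.assocFun_nonneg h0.le), Real.norm_of_nonneg h0.le]
  have h1 := mul_le_mul_of_nonneg_left ((Real.log_le_sub_one_of_pos h0).trans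
    (sub_le_self t zero_le_one)) hK
  have := h t ht
  rw [div_eq_mul_one_div] at this
  linarith

theorem LimRootTop.om5 (hM : IsLC M) (h : LimRootTop M) : Om5 (assocFun M) := by
  refine isLittleO_iff.2 fun c hc => ?_
  -- With `ε = 2 / c` the linear term is `c t / 2`, leaving the other half for `K log t`.
  obtain ⟨K, hK, h⟩ := hM.assocFun_le_div_add (by positivity : 0 < 2 / c)
    (h.eventually_ge_atTop (2 / c))
  filter_upwards [eventually_ge_atTop 1,
    (Real.isLittleO_log_id_atTop.const_mul_left K).bound (half_pos hc)] with t ht h1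
  have h0 : 0 < t := by linarith
  rw [Real.norm_of_nonneg (hM.assocFun_nonneg h0.le), Real.norm_of_nonneg h0.le]
  rw [id, Real.norm_of_nonneg h0.le] at h1
  have h2 := h t ht
  have h3 : t / (2 / c) = c / 2 * t := by field_simp
  linarith [le_abs_self (K * Real.log t), Real.norm_eq_abs (K * Real.log t)]

end Ultra

/-! ### Assembly of the theorem -/

theorem mainTheorem9 (M : ℕ → ℝ) (hM : Ultra.IsLC M) (hβ : Ultra.Beta3 M) (hmg : Ultra.ModerateGrowth M) :
    -- (1)
    (Ultra.AssocFinite M ∧ Ultra.IsW (Ultra.assocFun M) ∧ Ultra.Om6 (Ultra.assocFun M)) ∧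
    -- (2), where `N^l` is `Ultra.assocSeq (Ultra.assocFun M) l`
    (Ultra.ConjFinite (Ultra.assocFun M) ∧
      (∀ r s : ℕ, 0 < r → 0 < s →
        ∀ U : TopologicalSpace.Opens (EuclideanSpace ℝ (Fin r)),
          (U : Set (EuclideanSpace ℝ (Fin r))).Nonempty →
        ∀ (T : Ultra.ClassType) (l : ℝ), 0 < l →
          Ultra.funSpace (EuclideanSpace ℝ (Fin s)) T (Ultra.assocFun M) U =
            Ultra.seqSpace (EuclideanSpace ℝ (Fin s)) T (Ultra.assocSeq (Ultra.assocFun M) l) U ∧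
          Ultra.seqSpace (EuclideanSpace ℝ (Fin s)) T (Ultra.assocSeq (Ultra.assocFun M) l) U =
            Ultra.seqSpace (EuclideanSpace ℝ (Fin s)) T M U) ∧
      Ultra.assocSeq (Ultra.assocFun M) 1 = M ∧
      ∀ l : ℝ, 0 < l →
        (Ultra.IsLC (Ultra.assocSeq (Ultra.assocFun M) l) ∧ Ultra.ModerateGrowth (Ultra.assocSeq (Ultra.assocFun M) l)) ∧
        (Ultra.AssocFinite (Ultra.assocSeq (Ultra.assocFun M) l) ∧
          Ultra.FunEquiv (Ultra.assocFun (Ultra.assocSeq (Ultra.assocFun M) l)) (Ultra.assocFun M) ∧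
          Ultra.IsW (Ultra.assocFun (Ultra.assocSeq (Ultra.assocFun M) l)) ∧
          Ultra.Om6 (Ultra.assocFun (Ultra.assocSeq (Ultra.assocFun M) l))) ∧
        Ultra.SeqEquiv M (Ultra.assocSeq (Ultra.assocFun M) l)) ∧
    -- (3)
    (Ultra.LiminfRootPos M →
      Ultra.Om2 (Ultra.assocFun M) ∧
      ∀ l : ℝ, 0 < l →
        Ultra.Om2 (Ultra.assocFun (Ultra.assocSeq (Ultra.assocFun M) l)) ∧
        Ultra.Beta3 (Ultra.assocSeq (Ultra.assocFun M) l) ∧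
        Ultra.LiminfRootPos (Ultra.assocSeq (Ultra.assocFun M) l)) ∧
    (Ultra.LimRootTop M →
      Ultra.Om5 (Ultra.assocFun M) ∧
      ∀ l : ℝ, 0 < l →
        Ultra.Om5 (Ultra.assocFun (Ultra.assocSeq (Ultra.assocFun M) l)) ∧
        Ultra.LimRootTop (Ultra.assocSeq (Ultra.assocFun M) l)) := by
  have hω : Ultra.IsW (Ultra.assocFun M) := ⟨hM.isW0, hβ.om1 hM⟩
  have h6 := hM.om6 hmg
  have hN : ∀ l : ℝ, 0 < l → Ultra.IsLC (Ultra.assocSeq (Ultra.assocFun M) l) :=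
    fun l hl => hω.isLC_assocSeq hl
  have hone := hM.assocSeq_one
  have hMN : ∀ l : ℝ, 0 < l → Ultra.SeqEquiv M (Ultra.assocSeq (Ultra.assocFun M) l) := by
    intro l hl
    have h₁ := hω.seqLE_assocSeq h6 one_pos hl
    have h₂ := hω.seqLE_assocSeq h6 hl one_pos
    rw [hone] at h₁ h₂
    exact ⟨h₁, h₂⟩
  have hmgN := fun l hl => (hMN l hl).moderateGrowth hM (hN l hl) hmg
  have hf := fun l hl => (hMN l hl).funEquiv hM (hN l hl) hω
  refine ⟨⟨hM.assocFinite, hω, h6⟩, ⟨hω.conjFinite, ?_, hone, fun l hl => ?_⟩, fun h => ?_,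
    fun h => ?_⟩
  · intro r s _ _ U _ T l hl
    have h₁ := hω.funSpace_eq_seqSpace h6 hl (F := EuclideanSpace ℝ (Fin s)) T U
    -- The space of `M` enters as that of `N^1`, so both equalities are instances of the same
    -- statement.
    have h₂ := hω.funSpace_eq_seqSpace h6 one_pos (F := EuclideanSpace ℝ (Fin s)) T U
    rw [hone] at h₂
    exact ⟨h₁, h₁.symm.trans h₂⟩
  · exact ⟨⟨hN l hl, hmgN l hl⟩, ⟨(hN l hl).assocFinite, hf l hl, (hf l hl).isW (hN l hl) hω,
      (hN l hl).om6 (hmgN l hl)⟩, hMN l hl⟩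
  · have h2 := h.om2 hM
    exact ⟨h2, fun l hl => ⟨(hf l hl).2.trans h2,
      (hMN l hl).beta3 hM (hN l hl) hmg (hmgN l hl) hβ,
      (hMN l hl).1.liminfRootPos hM (hN l hl) h⟩⟩
  · have h5 := h.om5 hM
    exact ⟨h5, fun l hl => ⟨(hf l hl).2.trans_isLittleO h5,
      (hMN l hl).1.limRootTop hM (hN l hl) h⟩⟩
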